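/- Let $R$ be a commutative ring (for instance $\mathbb{Z}$ or a field). All operads are symmetric operads in $R$-modules. A dendriform algebra is an $R$-module $W$ with two bilinear products $\prec,\succ$ such that $(x\prec y)\prec z=x\prec(y\prec z)+x\prec(y\succ z)$, $(x\succ y)\prec z=x\succ(y\prec z)$ and $x\succ(y\succ z)=(x\succ y)\succ z+(x\prec y)\succ z$; $\mathrm{Dend}$ is the operad generated by two binary operations $\prec,\succ$ (without symmetry) subject to these relations. $\mathrm{Brace}$ is the quotient of the free operad on generators $C_n$ with $n+1$ inputs (without symmetry), $n\ge 1$, written $\{x_1\mid x_2,\dots,x_{n+1}\}$, by the relations, for $n,m\ge 1$, $$\{\{z\mid x_1,\dots,x_n\}\mid y_1,\dots,y_m\}=\sum \{z\mid Y_0,\{x_1\mid Y_1\},Y_2,\{x_2\mid Y_3\},Y_4,\dots,\{x_n\mid Y_{2n-1}\},Y_{2n}\},$$ where the sum is over the partitions of the ordered set $\{y_1,\dots,y_m\}$ into successive, possibly empty, intervals $Y_0\sqcup\dots\sqcup Y_{2n}$, and $\{x\mid\emptyset\}=x$. The class of $C_n$ in $\mathrm{Brace}(n+1)$ is the corolla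 $\mathrm{Corl}_n$. A brace algebra is an $R$-module with multilinear operations $\{x_1\mid x_2,\dots,x_{n+1}\}$, $n\ge1$, satisfying these relations. Put $\nearrow(x_1)=x_1$, $\nearrow(x_1,\dots,x_n)=x_1\prec\nearrow(x_2,\dots,x_n)$ and $\searrow(x_1)=x_1$, $\searrow(x_1,\dots,x_{n+1})=\searrow(x_1,\dots,x_n)\succ x_{n+1}$. Proposition. There is a unique morphism of operads $\psi:\mathrm{Brace}\to\mathrm{Dend}$ such that, for all $n\ge1$, $\psi(\mathrm{Corl}_n)\in\mathrm{Dend}(n+1)$ is the operation $$(x_1,\dots,x_{n+1})\longmapsto\sum_{i=1}^{n+1}(-1)^{i-1}\,\nearrow(x_2,\dots,x_i)\succ x_1\prec\searrow(x_{i+1},\dots,x_{n+1}),$$ where the term for $i=1$ is $x_1\prec\searrow(x_2,\dots,x_{n+1})$ and the term for $i=n+1$ is $(-1)^{n}\nearrow(x_2,\dots,x_{n+1})\succ x_1$ (the other terms are unambiguous since $(a\succ b)\prec c=a\succ(b\prec c)$). In particular, every dendriform algebra, with the operations $\{x_1\mid x_2,\dots,x_{n+1}\}$ given by this formula, is a brace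 algebra. -/

import Mathlib

/-!
# Symmetric operads, the operads `Brace` and `Dend`

Symmetric operads are written in the coordinate-free form: an operad `P` has a module `P(I)` for
every finite set `I`, relabellings along bijections of finite sets, a unit in `P({*})`, and
compositions `P(I) × ∏ i, P(J i) → P(⨆ i, J i)`.
-/

universe u v w

/-- A symmetric operad in `R`-modules. -/
structure SymmOperad (R : Type u) [CommRing R] where
  /-- the module `P(I)` of operations whose inputs are labelled by the finite set `I` -/
  obj : (I : Type) → [Finite I] → Type v
  [acg : ∀ (I : Type) [Finite I], AddCommGroup (obj I)]
  [mod : ∀ (I : Type) [Finite I], Module R (obj I)]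
  /-- relabelling of the inputs (the action of the symmetric groups when `I = J`) -/
  map : ∀ {I J : Type} [Finite I] [Finite J], (I ≃ J) → obj I →ₗ[R] obj J
  /-- the unit -/
  one : obj Unit
  /-- `comp x y` is the operation `x` with `y i` plugged into its input `i`, for all `i` -/
  comp : ∀ {I : Type} [Finite I] {J : I → Type} [∀ i, Finite (J i)],
    obj I →ₗ[R] MultilinearMap R (fun i => obj (J i)) (obj (Σ i, J i))
  map_refl : ∀ {I : Type} [Finite I] (x : obj I), map (Equiv.refl I) x = x
  map_trans : ∀ {I J K : Type} [Finite I] [Finite J] [Finite K] (e : I ≃ J) (f : J ≃ K)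
    (x : obj I), map (e.trans f) x = map f (map e x)
  comp_map_left : ∀ {I I' : Type} [Finite I] [Finite I'] {J : I' → Type} [∀ i, Finite (J i)]
    (e : I ≃ I') (x : obj I) (y : ∀ i, obj (J i)),
    comp (map e x) y = map (Equiv.sigmaCongrLeft e) (comp x fun i => y (e i))
  comp_map_right : ∀ {I : Type} [Finite I] {J K : I → Type} [∀ i, Finite (J i)]
    [∀ i, Finite (K i)] (e : ∀ i, J i ≃ K i) (x : obj I) (y : ∀ i, obj (J i)),
    comp x (fun i => map (e i) (y i)) = map (Equiv.sigmaCongrRight e) (comp x y)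
  one_comp : ∀ {I : Type} [Finite I] (y : obj I),
    map (Equiv.uniqueSigma fun _ : Unit => I) (comp one fun _ => y) = y
  comp_one : ∀ {I : Type} [Finite I] (x : obj I),
    map (Equiv.sigmaUnique I fun _ => Unit) (comp x fun _ => one) = x
  comp_assoc : ∀ {I : Type} [Finite I] {J : I → Type} [∀ i, Finite (J i)]
    {K : ∀ i, J i → Type} [∀ i j, Finite (K i j)]
    (x : obj I) (y : ∀ i, obj (J i)) (z : ∀ i (j : J i), obj (K i j)),
    comp (comp x y) (fun p => z p.1 p.2) =
      map (Equiv.sigmaAssoc K).symm (comp x fun i => comp (y i) (z i))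

namespace SymmOperad

attribute [instance] SymmOperad.acg SymmOperad.mod

variable {R : Type u} [CommRing R]

/-- A morphism of symmetric operads. -/
structure Hom (P : SymmOperad.{u, v} R) (Q : SymmOperad.{u, w} R) where
  app : ∀ (I : Type) [Finite I], P.obj I →ₗ[R] Q.obj I
  app_map : ∀ {I J : Type} [Finite I] [Finite J] (e : I ≃ J) (x : P.obj I),
    app J (P.map e x) = Q.map e (app I x)
  app_one : app Unit P.one = Q.one
  app_comp : ∀ {I : Type} [Finite I] {J : I → Type} [∀ i, Finite (J i)]
    (x : P.obj I) (y : ∀ i, P.obj (J i)),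
    app (Σ i, J i) (P.comp x y) = Q.comp (app I x) fun i => app (J i) (y i)

/-! ### Quotient of an operad by the ideal generated by a family of relators -/

/-- Membership in the operadic ideal of `P` generated by the relators `rel`. -/
inductive IdealMem (P : SymmOperad.{u, v} R) (rel : ∀ (I : Type) [Finite I], P.obj I → Prop) :
    ∀ (I : Type) [Finite I], P.obj I → Prop
  | of {I : Type} [Finite I] (x : P.obj I) (h : rel I x) : IdealMem P rel I x
  | zero {I : Type} [Finite I] : IdealMem P rel I 0
  | add {I : Type} [Finite I] (x y : P.obj I) (hx : IdealMem P rel I x)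
      (hy : IdealMem P rel I y) : IdealMem P rel I (x + y)
  | smul {I : Type} [Finite I] (c : R) (x : P.obj I) (hx : IdealMem P rel I x) :
      IdealMem P rel I (c • x)
  | map {I J : Type} [Finite I] [Finite J] (e : I ≃ J) (x : P.obj I)
      (hx : IdealMem P rel I x) : IdealMem P rel J (P.map e x)
  | comp_left {I : Type} [Finite I] {J : I → Type} [∀ i, Finite (J i)] (x : P.obj I)
      (y : ∀ i, P.obj (J i)) (hx : IdealMem P rel I x) :
      IdealMem P rel (Σ i, J i) (P.comp x y)
  | comp_right {I : Type} [Finite I] {J : I → Type} [∀ i, Finite (J i)] (x : P.obj I)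
      (y : ∀ i, P.obj (J i)) (i : I) (hy : IdealMem P rel (J i) (y i)) :
      IdealMem P rel (Σ i, J i) (P.comp x y)

/-- The component at `I` of the operadic ideal generated by `rel`. -/
def ideal (P : SymmOperad.{u, v} R) (rel : ∀ (I : Type) [Finite I], P.obj I → Prop)
    (I : Type) [Finite I] : Submodule R (P.obj I) where
  carrier := {x | IdealMem P rel I x}
  zero_mem' := .zero
  add_mem' := fun {a b} ha hb => .add a b ha hb
  smul_mem' := fun c x hx => .smul c x hx

section Descend

variable {ι : Type} [Finite ι] {M : ι → Type v} [∀ i, AddCommGroup (M i)] [∀ i, Module R (M i)]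
  {N : Type w} [AddCommGroup N] [Module R N]

theorem multilinear_congr (g : MultilinearMap R M N) (K : ∀ i, Submodule R (M i))
    (h : ∀ m i, m i ∈ K i → g m = 0) (m m' : ∀ i, M i) (hm : ∀ i, m i - m' i ∈ K i) :
    g m = g m' := by
  classical
  cases nonempty_fintype ι
  have key : ∀ s : Finset ι, g (s.piecewise m m') = g m' := by
    intro s
    induction s using Finset.induction_on with
    | empty => simp
    | insert a s ha ih =>
      rw [Finset.piecewise_insert, ← ih, ← sub_eq_zero]
      have h1 : g (s.piecewise m m') =
          g (Function.update (s.piecewise m m') a (m' a)) := by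
        congr 1
        ext i
        by_cases hi : i = a
        · subst hi; simp [ha]
        · simp [hi]
      rw [h1, ← MultilinearMap.map_update_sub]
      exact h _ a (by simpa using hm a)
  simpa using key Finset.univ

/-- A multilinear map that vanishes as soon as one argument lies in `K i` descends to the
quotients. -/
noncomputable def descend (g : MultilinearMap R M N) (K : ∀ i, Submodule R (M i))
    (h : ∀ m i, m i ∈ K i → g m = 0) : MultilinearMap R (fun i => M i ⧸ K i) N :=
  have key : ∀ (q : ∀ i, M i ⧸ K i) (m : ∀ i, M i), (∀ i, q i = Submodule.Quotient.mk (m i)) →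
      g (fun i => (q i).out) = g m := fun q m hq =>
    multilinear_congr g K h _ _ fun i => by
      rw [← Submodule.Quotient.eq, ← hq i]
      exact Quotient.out_eq' (q i)
  { toFun := fun q => g fun i => (q i).out
    map_update_add' := fun {_} q i a b => by
      obtain ⟨a, rfl⟩ := Submodule.Quotient.mk_surjective _ a
      obtain ⟨b, rfl⟩ := Submodule.Quotient.mk_surjective _ b
      have hu : ∀ c : M i, ∀ j, Function.update q i (Submodule.Quotient.mk c) j =
          Submodule.Quotient.mk (Function.update (fun k => (q k).out) i c j) := by
        intro c j
        by_cases hj : j = i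
        · subst hj; simp
        · simp only [Function.update_of_ne hj]
          exact (Quotient.out_eq' (q j)).symm
      rw [key _ _ (hu a), key _ _ (hu b), ← Submodule.Quotient.mk_add, key _ _ (hu (a + b)),
        MultilinearMap.map_update_add]
    map_update_smul' := fun {_} q i c a => by
      obtain ⟨a, rfl⟩ := Submodule.Quotient.mk_surjective _ a
      have hu : ∀ c : M i, ∀ j, Function.update q i (Submodule.Quotient.mk c) j =
          Submodule.Quotient.mk (Function.update (fun k => (q k).out) i c j) := by
        intro c j
        by_cases hj : j = i
        · subst hj; simp
        · simp only [Function.update_of_ne hj]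
          exact (Quotient.out_eq' (q j)).symm
      rw [key _ _ (hu a), ← Submodule.Quotient.mk_smul, key _ _ (hu (c • a)),
        MultilinearMap.map_update_smul] }

theorem descend_mk (g : MultilinearMap R M N) (K : ∀ i, Submodule R (M i))
    (h : ∀ m i, m i ∈ K i → g m = 0) (m : ∀ i, M i) :
    descend g K h (fun i => Submodule.Quotient.mk (m i)) = g m :=
  multilinear_congr g K h _ _ fun i => by
    rw [← Submodule.Quotient.eq]
    exact Quotient.out_eq' _

end Descend

section Quot

variable (P : SymmOperad.{u, v} R) (rel : ∀ (I : Type) [Finite I], P.obj I → Prop)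

theorem comp_left_mem {I : Type} [Finite I] {J : I → Type} [∀ i, Finite (J i)] (x : P.obj I)
    (y : ∀ i, P.obj (J i)) (hx : x ∈ P.ideal rel I) : P.comp x y ∈ P.ideal rel (Σ i, J i) :=
  IdealMem.comp_left x y hx

theorem comp_right_mem {I : Type} [Finite I] {J : I → Type} [∀ i, Finite (J i)] (x : P.obj I)
    (y : ∀ i, P.obj (J i)) (i : I) (hy : y i ∈ P.ideal rel (J i)) :
    P.comp x y ∈ P.ideal rel (Σ i, J i) :=
  IdealMem.comp_right x y i hy

theorem map_le {I J : Type} [Finite I] [Finite J] (e : I ≃ J) :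
    P.ideal rel I ≤ (P.ideal rel J).comap (P.map e) :=
  fun x hx => IdealMem.map e x hx

theorem comp_mkQ_eq_zero {I : Type} [Finite I] {J : I → Type} [∀ i, Finite (J i)] (x : P.obj I)
    (y : ∀ i, P.obj (J i)) (i : I) (hy : y i ∈ P.ideal rel (J i)) :
    (P.ideal rel (Σ i, J i)).mkQ.compMultilinearMap (P.comp x) y = 0 :=
  (Submodule.Quotient.mk_eq_zero _).2 (P.comp_right_mem rel x y i hy)

/-- Relabelling on the quotient. -/
def quotMap {I J : Type} [Finite I] [Finite J] (e : I ≃ J) :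
    (P.obj I ⧸ P.ideal rel I) →ₗ[R] (P.obj J ⧸ P.ideal rel J) :=
  (P.ideal rel I).mapQ (P.ideal rel J) (P.map e) (P.map_le rel e)

theorem quotMap_mk {I J : Type} [Finite I] [Finite J] (e : I ≃ J) (x : P.obj I) :
    P.quotMap rel e (Submodule.Quotient.mk x) = Submodule.Quotient.mk (P.map e x) :=
  rfl

theorem exists_rep {I : Type} {J : I → Type} [∀ i, Finite (J i)]
    (q : ∀ i, P.obj (J i) ⧸ P.ideal rel (J i)) :
    ∃ m : ∀ i, P.obj (J i), (fun i => Submodule.Quotient.mk (m i)) = q :=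
  ⟨fun i => (q i).out, funext fun i => Quotient.out_eq' (q i)⟩

/-- Composition on the quotient, with the first argument in `P`. -/
noncomputable def quotCompAux {I : Type} [Finite I] {J : I → Type} [∀ i, Finite (J i)] :
    P.obj I →ₗ[R] MultilinearMap R (fun i => P.obj (J i) ⧸ P.ideal rel (J i))
      (P.obj (Σ i, J i) ⧸ P.ideal rel (Σ i, J i)) where
  toFun x := descend ((P.ideal rel (Σ i, J i)).mkQ.compMultilinearMap (P.comp x))
    (fun i => P.ideal rel (J i)) (P.comp_mkQ_eq_zero rel x)
  map_add' x y := by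
    ext q
    obtain ⟨m, rfl⟩ := P.exists_rep rel q
    rw [add_apply, descend_mk, descend_mk, descend_mk]
    simp
  map_smul' c x := by
    ext q
    obtain ⟨m, rfl⟩ := P.exists_rep rel q
    rw [smul_apply, descend_mk, descend_mk]
    simp

theorem quotCompAux_mk {I : Type} [Finite I] {J : I → Type} [∀ i, Finite (J i)]
    (x : P.obj I) (y : ∀ i, P.obj (J i)) :
    P.quotCompAux rel x (fun i => Submodule.Quotient.mk (y i)) =
      Submodule.Quotient.mk (P.comp x y) :=
  descend_mk _ _ (P.comp_mkQ_eq_zero rel x) y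

theorem ideal_le_ker {I : Type} [Finite I] {J : I → Type} [∀ i, Finite (J i)] :
    P.ideal rel I ≤ LinearMap.ker (P.quotCompAux rel (I := I) (J := J)) := fun x hx => by
  rw [LinearMap.mem_ker]
  ext q
  obtain ⟨m, rfl⟩ := P.exists_rep rel q
  rw [quotCompAux_mk]
  exact (Submodule.Quotient.mk_eq_zero _).2 (P.comp_left_mem rel x m hx)

/-- Composition on the quotient. -/
noncomputable def quotComp {I : Type} [Finite I] {J : I → Type} [∀ i, Finite (J i)] :
    (P.obj I ⧸ P.ideal rel I) →ₗ[R] MultilinearMap R (fun i => P.obj (J i) ⧸ P.ideal rel (J i))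
      (P.obj (Σ i, J i) ⧸ P.ideal rel (Σ i, J i)) :=
  (P.ideal rel I).liftQ (P.quotCompAux rel) (P.ideal_le_ker rel)

theorem quotComp_mk {I : Type} [Finite I] {J : I → Type} [∀ i, Finite (J i)]
    (x : P.obj I) (y : ∀ i, P.obj (J i)) :
    P.quotComp rel (Submodule.Quotient.mk x) (fun i => Submodule.Quotient.mk (y i)) =
      Submodule.Quotient.mk (P.comp x y) :=
  P.quotCompAux_mk rel x y

/-- The quotient of `P` by the operadic ideal generated by `rel`. -/
noncomputable def quot : SymmOperad.{u, v} R where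
  obj I _ := P.obj I ⧸ P.ideal rel I
  map := P.quotMap rel
  one := Submodule.Quotient.mk P.one
  comp := P.quotComp rel
  map_refl x := by
    obtain ⟨x, rfl⟩ := Submodule.Quotient.mk_surjective _ x
    rw [quotMap_mk, P.map_refl]
  map_trans e f x := by
    obtain ⟨x, rfl⟩ := Submodule.Quotient.mk_surjective _ x
    rw [quotMap_mk, quotMap_mk, quotMap_mk, P.map_trans]
  comp_map_left e x y := by
    obtain ⟨x, rfl⟩ := Submodule.Quotient.mk_surjective _ x
    obtain ⟨y, rfl⟩ := P.exists_rep rel y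
    rw [quotMap_mk, quotComp_mk, P.comp_map_left, quotComp_mk P rel x fun i => y (e i),
      quotMap_mk]
  comp_map_right e x y := by
    obtain ⟨x, rfl⟩ := Submodule.Quotient.mk_surjective _ x
    obtain ⟨y, rfl⟩ := P.exists_rep rel y
    simp only [quotMap_mk]
    rw [quotComp_mk, quotComp_mk, P.comp_map_right, quotMap_mk]
  one_comp y := by
    obtain ⟨y, rfl⟩ := Submodule.Quotient.mk_surjective _ y
    rw [quotComp_mk P rel P.one fun _ => y, quotMap_mk, P.one_comp]
  comp_one x := by
    obtain ⟨x, rfl⟩ := Submodule.Quotient.mk_surjective _ x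
    rw [quotComp_mk P rel x fun _ => P.one, quotMap_mk, P.comp_one]
  comp_assoc {I _ J _ K _} x y z := by
    obtain ⟨x, rfl⟩ := Submodule.Quotient.mk_surjective _ x
    obtain ⟨y, rfl⟩ := P.exists_rep rel y
    obtain ⟨z, rfl⟩ : ∃ m : ∀ i (j : J i), P.obj (K i j),
        (fun i j => Submodule.Quotient.mk (m i j)) = z :=
      ⟨fun i j => (z i j).out, funext fun i => funext fun j => Quotient.out_eq' (z i j)⟩
    have h1 : ∀ i, P.quotComp rel (Submodule.Quotient.mk (y i))
        (fun j => Submodule.Quotient.mk (z i j)) = Submodule.Quotient.mk (P.comp (y i) (z i)) :=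
      fun i => quotComp_mk P rel _ _
    simp only [h1]
    rw [quotComp_mk, quotComp_mk P rel _ fun p : Σ i, J i => z p.1 p.2,
      quotComp_mk P rel x fun i => P.comp (y i) (z i), quotMap_mk, P.comp_assoc]

/-- The image of an element of `P` in the quotient. -/
def toQuot {I : Type} [Finite I] (x : P.obj I) : (P.quot rel).obj I :=
  Submodule.Quotient.mk (p := P.ideal rel I) x

end Quot

end SymmOperad

/-! ### Free operads -/

/-- Formal composites of operations `g : G`, where `g` takes a list of `ar g` inputs, with leaves
labelled in `I`. -/
inductive OpTree {G : Type} (ar : G → ℕ) (I : Type) : Type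
  | var (i : I) : OpTree ar I
  | op (g : G) (a : Fin (ar g) → OpTree ar I) : OpTree ar I

namespace OpTree

variable {G : Type} {ar : G → ℕ} {I J K : Type}

/-- Substitution of a tree for each leaf label. -/
def bind (f : I → OpTree ar J) : OpTree ar I → OpTree ar J
  | var i => f i
  | op g a => op g fun k => bind f (a k)

/-- Relabelling of the leaves. -/
def map (f : I → J) (t : OpTree ar I) : OpTree ar J := t.bind fun i => var (f i)

open Classical in
/-- The number of leaves labelled by `i`. -/
noncomputable def occ (i : I) : OpTree ar I → ℕ
  | var j => if j = i then 1 else 0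
  | op _ a => ∑ k, occ i (a k)

/-- Every label occurs exactly once: `t` is a multilinear monomial in the variables `I`. -/
def IsMultilinear (t : OpTree ar I) : Prop := ∀ i, t.occ i = 1

/-- Plug the tree `s i` into the leaf `i` of `t`, for all `i`. -/
def graft {J : I → Type} (t : OpTree ar I) (s : ∀ i, OpTree ar (J i)) : OpTree ar (Σ i, J i) :=
  t.bind fun i => (s i).map (Sigma.mk i)

theorem bind_bind (f : I → OpTree ar J) (g : J → OpTree ar K) (t : OpTree ar I) :
    (t.bind f).bind g = t.bind fun i => (f i).bind g := by
  induction t with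
  | var i => rfl
  | op _ a ih => simp [bind, ih]

theorem bind_var (t : OpTree ar I) : t.bind var = t := by
  induction t with
  | var i => rfl
  | op _ a ih => simp [bind, ih]

theorem occ_map_of_injective {f : I → J} (hf : Function.Injective f) (t : OpTree ar I) (i : I) :
    (t.map f).occ (f i) = t.occ i := by
  induction t with
  | var j =>
    by_cases h : j = i
    · simp [map, bind, occ, h]
    · simp [map, bind, occ, h, hf.eq_iff]
  | op _ a ih => simpa [map, bind, occ] using Finset.sum_congr rfl fun k _ => ih k

theorem occ_map_of_notMem {f : I → J} {j : J} (hj : ∀ i, f i ≠ j) (t : OpTree ar I) :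
    (t.map f).occ j = 0 := by
  induction t with
  | var i => simp [map, bind, occ, hj]
  | op _ a ih => simpa [map, bind, occ] using ih

theorem occ_graft {J : I → Type} (t : OpTree ar I) (s : ∀ i, OpTree ar (J i)) (i : I) (j : J i) :
    (t.graft s).occ ⟨i, j⟩ = t.occ i * (s i).occ j := by
  induction t with
  | var i' =>
    by_cases h : i' = i
    · subst h
      simp only [graft, bind, occ, if_true, one_mul]
      exact occ_map_of_injective sigma_mk_injective _ _
    · simp only [graft, bind, occ, if_neg h, zero_mul]
      exact occ_map_of_notMem (fun k hk => h (congrArg Sigma.fst hk)) _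
  | op _ a ih =>
    simp only [graft, bind, occ, Finset.sum_mul]
    exact Finset.sum_congr rfl fun k _ => ih k

theorem IsMultilinear.map {t : OpTree ar I} (ht : t.IsMultilinear) (e : I ≃ J) :
    (t.map e).IsMultilinear := fun j => by
  obtain ⟨i, rfl⟩ := e.surjective j
  rw [occ_map_of_injective e.injective, ht]

theorem IsMultilinear.graft {J : I → Type} {t : OpTree ar I} (ht : t.IsMultilinear)
    {s : ∀ i, OpTree ar (J i)} (hs : ∀ i, (s i).IsMultilinear) : (t.graft s).IsMultilinear := by
  rintro ⟨i, j⟩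
  rw [occ_graft, ht, hs, mul_one]

end OpTree

/-- Multilinear monomials with inputs labelled by `I`. -/
def Monomial {G : Type} (ar : G → ℕ) (I : Type) : Type := {t : OpTree ar I // t.IsMultilinear}

namespace Monomial

variable {G : Type} {ar : G → ℕ} {I J : Type}

/-- Relabelling of a monomial. -/
def relabel (e : I ≃ J) (t : Monomial ar I) : Monomial ar J := ⟨t.1.map e, t.2.map e⟩

/-- The trivial monomial. -/
def unit : Monomial ar Unit := ⟨.var (), fun _ => by simp [OpTree.occ]⟩

/-- Composition of monomials. -/
def graft {J : I → Type} (t : Monomial ar I) (s : ∀ i, Monomial ar (J i)) :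
    Monomial ar (Σ i, J i) := ⟨t.1.graft fun i => (s i).1, t.2.graft fun i => (s i).2⟩

theorem relabel_refl (t : Monomial ar I) : t.relabel (Equiv.refl I) = t :=
  Subtype.ext (OpTree.bind_var _)

theorem relabel_trans {K : Type} (e : I ≃ J) (f : J ≃ K) (t : Monomial ar I) :
    t.relabel (e.trans f) = (t.relabel e).relabel f :=
  Subtype.ext (OpTree.bind_bind (fun i => .var (e i)) (fun i => .var (f i)) t.1).symm

theorem graft_relabel_left {I' : Type} {J : I' → Type} (e : I ≃ I') (t : Monomial ar I)
    (s : ∀ i, Monomial ar (J i)) :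
    (t.relabel e).graft s = (t.graft fun i => s (e i)).relabel (Equiv.sigmaCongrLeft e) := by
  apply Subtype.ext
  simp [graft, relabel, OpTree.graft, OpTree.map, OpTree.bind_bind, OpTree.bind,
    Equiv.sigmaCongrLeft]

theorem graft_relabel_right {J K : I → Type} (e : ∀ i, J i ≃ K i) (t : Monomial ar I)
    (s : ∀ i, Monomial ar (J i)) :
    (t.graft fun i => (s i).relabel (e i)) = (t.graft s).relabel (Equiv.sigmaCongrRight e) := by
  apply Subtype.ext
  simp [graft, relabel, OpTree.graft, OpTree.map, OpTree.bind_bind, OpTree.bind]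

theorem unit_graft (s : Monomial ar I) :
    ((unit : Monomial ar Unit).graft fun _ => s).relabel (Equiv.uniqueSigma fun _ : Unit => I)
      = s := by
  apply Subtype.ext
  simp only [graft, relabel, unit, OpTree.graft, OpTree.map, OpTree.bind_bind, OpTree.bind]
  exact OpTree.bind_var _

theorem graft_unit (t : Monomial ar I) :
    (t.graft fun _ => unit).relabel (Equiv.sigmaUnique I fun _ => Unit) = t := by
  apply Subtype.ext
  simp only [graft, relabel, unit, OpTree.graft, OpTree.map, OpTree.bind_bind, OpTree.bind]
  exact OpTree.bind_var _

theorem graft_assoc {J : I → Type} {K : ∀ i, J i → Type} (t : Monomial ar I)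
    (s : ∀ i, Monomial ar (J i)) (r : ∀ i (j : J i), Monomial ar (K i j)) :
    ((t.graft s).graft fun p => r p.1 p.2) =
      (t.graft fun i => (s i).graft (r i)).relabel (Equiv.sigmaAssoc K).symm := by
  apply Subtype.ext
  simp [graft, relabel, OpTree.graft, OpTree.map, OpTree.bind_bind, OpTree.bind,
    Equiv.sigmaAssoc]

end Monomial

namespace SymmOperad

section Free

variable (R : Type u) [CommRing R] {G : Type} (ar : G → ℕ)

open Classical in
/-- The multilinear extension of the composition of monomials `s ↦ t.graft s`. -/
noncomputable def freeCompMon {I : Type} [Finite I] {J : I → Type} (t : Monomial ar I) :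
    MultilinearMap R (fun i => Monomial ar (J i) →₀ R) (Monomial ar (Σ i, J i) →₀ R) :=
  letI := Fintype.ofFinite I
  (MultilinearMap.fromDFinsuppEquiv (fun i => Monomial ar (J i)) R fun s =>
    MultilinearMap.mkPiRing R I (Finsupp.single (t.graft s) (1 : R))).compLinearMap
    fun _ => (finsuppLequivDFinsupp R).toLinearMap

theorem freeCompMon_single {I : Type} [Finite I] {J : I → Type} (t : Monomial ar I)
    (s : ∀ i, Monomial ar (J i)) :
    freeCompMon R ar t (fun i => Finsupp.single (s i) 1) = Finsupp.single (t.graft s) 1 := by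
  classical
  let := Fintype.ofFinite I
  simp only [freeCompMon, MultilinearMap.compLinearMap_apply]
  have : (fun i => (finsuppLequivDFinsupp R).toLinearMap (Finsupp.single (s i) (1 : R))) =
      fun i => (DFinsupp.single (s i) (1 : R) : Π₀ _ : Monomial ar (J i), R) := by
    funext i
    simp
  rw [this]
  convert MultilinearMap.fromDFinsuppEquiv_single (R := R) (κ := fun i => Monomial ar (J i))
    (M := fun _ _ => R) (fun s => MultilinearMap.mkPiRing R I
      (Finsupp.single (Monomial.graft t s) (1 : R))) s (fun _ => 1) using 1
  simp

/-- Composition in the free operad: the multilinear extension of grafting. -/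
noncomputable def freeComp {I : Type} [Finite I] {J : I → Type} :
    (Monomial ar I →₀ R) →ₗ[R]
      MultilinearMap R (fun i => Monomial ar (J i) →₀ R) (Monomial ar (Σ i, J i) →₀ R) :=
  Finsupp.linearCombination R (freeCompMon R ar)

theorem freeComp_single {I : Type} [Finite I] {J : I → Type} (t : Monomial ar I)
    (s : ∀ i, Monomial ar (J i)) :
    freeComp R ar (Finsupp.single t 1) (fun i => Finsupp.single (s i) 1) =
      Finsupp.single (t.graft s) 1 := by
  simp [freeComp, freeCompMon_single]

theorem mon_ext {I : Type} [Finite I] {J : I → Type} {N : Type*} [AddCommGroup N] [Module R N]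
    (f g : (Monomial ar I →₀ R) →ₗ[R] MultilinearMap R (fun i => Monomial ar (J i) →₀ R) N)
    (h : ∀ (t : Monomial ar I) (s : ∀ i, Monomial ar (J i)),
      f (Finsupp.single t 1) (fun i => Finsupp.single (s i) 1) =
        g (Finsupp.single t 1) fun i => Finsupp.single (s i) 1) : f = g := by
  ext t : 2
  refine Module.Basis.ext_multilinear (fun i => Finsupp.basisSingleOne) fun s => ?_
  simpa using h t s

/-- Reindexing of the arguments of a multilinear map along a bijection. -/
def reindex {I I' : Type} (e : I ≃ I') {M : I' → Type v} [∀ i, AddCommGroup (M i)]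
    [∀ i, Module R (M i)] {N : Type w} [AddCommGroup N] [Module R N]
    (g : MultilinearMap R (fun i => M (e i)) N) : MultilinearMap R M N where
  toFun y := g fun i => y (e i)
  map_update_add' {_} y i' a b := by
    classical
    obtain ⟨i, rfl⟩ := e.surjective i'
    have h : ∀ c, (fun j => Function.update y (e i) c (e j)) =
        Function.update (fun j => y (e j)) i c := by
      intro c
      funext j
      by_cases hj : j = i
      · subst hj; simp
      · simp [hj]
    simp only [h, MultilinearMap.map_update_add]
  map_update_smul' {_} y i' c a := by
    classical
    obtain ⟨i, rfl⟩ := e.surjective i'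
    have h : ∀ c, (fun j => Function.update y (e i) c (e j)) =
        Function.update (fun j => y (e j)) i c := by
      intro c
      funext j
      by_cases hj : j = i
      · subst hj; simp
      · simp [hj]
    simp only [h, MultilinearMap.map_update_smul]

/-- `freeComp` as a linear map of its first argument. -/
noncomputable def freeCompFlip {I : Type} [Finite I] {J : I → Type}
    (z : ∀ i, Monomial ar (J i) →₀ R) : (Monomial ar I →₀ R) →ₗ[R] (Monomial ar (Σ i, J i) →₀ R) where
  toFun x := freeComp R ar x z
  map_add' x y := by simp
  map_smul' c x := by simp

theorem lmap_single {I J : Type} (e : I ≃ J) (t : Monomial ar I) :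
    Finsupp.lmapDomain R R (Monomial.relabel (ar := ar) e) (Finsupp.single t 1) =
      Finsupp.single (t.relabel e) 1 := by
  simp

/-- The free symmetric operad on generators `g : G`, where `g` has inputs `Fin (ar g)` (and no
symmetry): `P(I)` is free on the multilinear monomials in the variables `I`. -/
noncomputable def free : SymmOperad.{u, u} R where
  obj I _ := Monomial ar I →₀ R
  map e := Finsupp.lmapDomain R R (Monomial.relabel e)
  one := Finsupp.single Monomial.unit 1
  comp := freeComp R ar
  map_refl {I} _ x := by
    have : Monomial.relabel (ar := ar) (Equiv.refl I) = id := funext Monomial.relabel_refl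
    rw [this, Finsupp.lmapDomain_id, LinearMap.id_apply]
  map_trans e f x := by
    have : Monomial.relabel (ar := ar) (e.trans f) = Monomial.relabel f ∘ Monomial.relabel e :=
      funext (Monomial.relabel_trans e f)
    rw [this, Finsupp.lmapDomain_comp, LinearMap.comp_apply]
  comp_map_left {I I' _ _ J _} e x y := by
    induction x using Finsupp.induction_linear with
    | zero => simp
    | add f g hf hg => simp only [map_add, add_apply, hf, hg]
    | single t c =>
      rw [← mul_one c, ← smul_eq_mul, ← Finsupp.smul_single]
      simp only [map_smul, smul_apply, lmap_single]
      congr 1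
      have key : freeComp R ar (J := J) (Finsupp.single (t.relabel e) 1) =
          (Finsupp.lmapDomain R R
            (Monomial.relabel (ar := ar) (Equiv.sigmaCongrLeft e))).compMultilinearMap
            (reindex R e (M := fun i' => Monomial ar (J i') →₀ R)
              (freeComp R ar (J := fun i => J (e i)) (Finsupp.single t 1))) := by
        refine Module.Basis.ext_multilinear (fun i => Finsupp.basisSingleOne) fun s => ?_
        simp only [Finsupp.coe_basisSingleOne, LinearMap.compMultilinearMap_apply, reindex,
          MultilinearMap.coe_mk]
        rw [freeComp_single, freeComp_single R ar t fun i => s (e i), lmap_single,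
          Monomial.graft_relabel_left]
      exact congrArg (fun F => F y) key
  comp_map_right {I _ J K _ _} e x y := by
    have key : (LinearMap.comp (MultilinearMap.compLinearMapₗ fun i =>
          Finsupp.lmapDomain R R (Monomial.relabel (ar := ar) (e i))) (freeComp R ar (J := K))) =
        ((LinearMap.compMultilinearMapₗ R (Finsupp.lmapDomain R R
          (Monomial.relabel (ar := ar) (Equiv.sigmaCongrRight e)))).comp
          (freeComp R ar (J := J))) := by
      refine mon_ext R ar _ _ fun t s => ?_
      simp only [LinearMap.comp_apply, MultilinearMap.compLinearMapₗ_apply,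
        MultilinearMap.compLinearMap_apply, LinearMap.compMultilinearMapₗ_apply,
        LinearMap.compMultilinearMap_apply, freeComp_single, lmap_single,
        Monomial.graft_relabel_right]
    exact congrArg (fun F => F x y) key
  one_comp {I} _ y := by
    have key : (LinearMap.compMultilinearMapₗ R (Finsupp.lmapDomain R R
          (Monomial.relabel (ar := ar) (Equiv.uniqueSigma fun _ : Unit => I))))
          (freeComp R ar (J := fun _ : Unit => I) (Finsupp.single Monomial.unit 1)) =
        MultilinearMap.ofSubsingleton R (Monomial ar I →₀ R) (Monomial ar I →₀ R) ()
          LinearMap.id := by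
      refine Module.Basis.ext_multilinear (fun i => Finsupp.basisSingleOne) fun s => ?_
      simp only [Finsupp.coe_basisSingleOne, LinearMap.compMultilinearMapₗ_apply,
        LinearMap.compMultilinearMap_apply, freeComp_single, lmap_single,
        MultilinearMap.ofSubsingleton_apply_apply, LinearMap.id_apply]
      rw [show s = fun _ => s () from rfl, Monomial.unit_graft]
    exact congrArg (fun F => F fun _ => y) key
  comp_one x := by
    induction x using Finsupp.induction_linear with
    | zero => simp
    | add f g hf hg => rw [map_add, add_apply, map_add, hf, hg]
    | single t c =>
      rw [← mul_one c, ← smul_eq_mul, ← Finsupp.smul_single, map_smul, smul_apply, map_smul,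
        freeComp_single, lmap_single, Monomial.graft_unit]
  comp_assoc {I _ J _ K _} x y z := by
    induction x using Finsupp.induction_linear with
    | zero => simp
    | add f g hf hg => simp only [map_add, add_apply, hf, hg]
    | single t c =>
      rw [← mul_one c, ← smul_eq_mul, ← Finsupp.smul_single]
      simp only [map_smul, smul_apply]
      congr 1
      have key : (freeCompFlip R ar (J := fun p : Σ i, J i => K p.1 p.2)
          (fun p => z p.1 p.2)).compMultilinearMap (freeComp R ar (Finsupp.single t 1)) =
          (Finsupp.lmapDomain R R (Monomial.relabel (ar := ar) (Equiv.sigmaAssoc K).symm)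
            ).compMultilinearMap ((freeComp R ar (Finsupp.single t 1)).compLinearMap fun i =>
              freeCompFlip R ar (J := K i) (z i)) := by
        refine Module.Basis.ext_multilinear (fun i => Finsupp.basisSingleOne) fun s => ?_
        simp only [Finsupp.coe_basisSingleOne, LinearMap.compMultilinearMap_apply, freeCompFlip,
          MultilinearMap.compLinearMap_apply, LinearMap.coe_mk, AddHom.coe_mk, freeComp_single]
        have key' : freeComp R ar (J := fun p : Σ i, J i => K p.1 p.2)
            (Finsupp.single (t.graft s) 1) =
            (Finsupp.lmapDomain R R (Monomial.relabel (ar := ar) (Equiv.sigmaAssoc K).symm)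
              ).compMultilinearMap ((freeComp R ar (J := fun i => Σ j, K i j)
                (Finsupp.single t 1)).compMultilinearMap
                fun i => freeComp R ar (J := K i) (Finsupp.single (s i) 1)) := by
          refine Module.Basis.ext_multilinear (fun i => Finsupp.basisSingleOne) fun r => ?_
          simp only [Finsupp.coe_basisSingleOne]
          change freeComp R ar _ _ = Finsupp.lmapDomain R R _ (freeComp R ar (Finsupp.single t 1)
            fun i => freeComp R ar (Finsupp.single (s i) 1)
              fun j => Finsupp.single (r ⟨i, j⟩) 1)
          simp only [freeComp_single]
          rw [lmap_single]
          rw [← Monomial.graft_assoc t s fun i j => r ⟨i, j⟩]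
        exact congrArg (fun F => F fun p => z p.1 p.2) key'
      exact congrArg (fun F => F y) key

end Free
end SymmOperad

/-- The monomial `t` as an element of the free operad. -/
noncomputable def SymmOperad.mon (R : Type u) [CommRing R] {G : Type} {ar : G → ℕ} {I : Type}
    [Finite I] (t : OpTree ar I) (ht : t.IsMultilinear) : (SymmOperad.free R ar).obj I :=
  Finsupp.single (M := R) (⟨t, ht⟩ : Monomial ar I) 1

/-! ### The brace relations

A family of brace operations on a set `A` is written as one map `br : A → List A → A`, where
`br z [x₁, …, xₙ]` is `{z | x₁, …, xₙ}` and `br z []` is `z`. -/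

section BraceRelations

variable {A : Type w}

/-- For `f : Fin m → Fin k`, the list of those `y a` with `f a = j`, in their given order. When `f`
is monotone, these are successive, possibly empty, intervals of `y 0, …, y (m - 1)`. -/
def block {m k : ℕ} (y : Fin m → A) (f : Fin m → Fin k) (j : ℕ) : List A :=
  ((List.finRange m).filter fun a => (f a : ℕ) = j).map y

/-- The list `Y₀, {x₁ | Y₁}, Y₂, {x₂ | Y₃}, Y₄, …, {xₙ | Y₂ₙ₋₁}, Y₂ₙ`. -/
def braceArgs (br : A → List A → A) {n : ℕ} (x : Fin n → A) (Y : ℕ → List A) : List A :=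
  Y 0 ++ (List.finRange n).flatMap fun i => br (x i) (Y (2 * i + 1)) :: Y (2 * i + 2)

/-- `{{z | x₁, …, xₙ} | y₁, …, yₘ}` -/
def braceLHS (br : A → List A → A) {n m : ℕ} (z : A) (x : Fin n → A) (y : Fin m → A) : A :=
  br (br z (List.ofFn x)) (List.ofFn y)

/-- `{z | Y₀, {x₁ | Y₁}, Y₂, …, {xₙ | Y₂ₙ₋₁}, Y₂ₙ}`, where `Yⱼ` consists of the `y a` with
`f a = j`. -/
def braceRHS (br : A → List A → A) {n m : ℕ} (z : A) (x : Fin n → A) (y : Fin m → A)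
    (f : Fin m → Fin (2 * n + 1)) : A :=
  br z (braceArgs br x (block y f))

/-- The weakly increasing maps `f : Fin m → Fin (2 n + 1)`, i.e. the partitions of
`y₁, …, yₘ` into successive, possibly empty, intervals `Y₀, …, Y₂ₙ`. -/
noncomputable def intervalPartitions (n m : ℕ) : Finset (Fin m → Fin (2 * n + 1)) :=
  letI := Classical.decPred fun f : Fin m → Fin (2 * n + 1) => Monotone f
  Finset.univ.filter fun f => Monotone f

end BraceRelations

/-- `br` makes the `R`-module `A` a brace algebra. -/
structure IsBraceAlgebra (R : Type u) [CommRing R] {A : Type w} [AddCommGroup A] [Module R A]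
    (br : A → List A → A) : Prop where
  nil : ∀ z, br z [] = z
  multilinear : ∀ n : ℕ, ∃ M : MultilinearMap R (fun _ : Fin (n + 1) => A) A,
    ∀ v, M v = br (v 0) (List.ofFn fun i : Fin n => v i.succ)
  rel : ∀ (n m : ℕ) (z : A) (x : Fin n → A) (y : Fin m → A),
    braceLHS br z x y = ∑ f ∈ intervalPartitions n m, braceRHS br z x y f

/-! ### The operad `Brace` -/

namespace BraceOperad

/-- The generators are indexed by `ℕ`; the generator with index `n` is `Cₙ₊₁`, with `n + 2`
inputs. -/
abbrev ar : ℕ → ℕ := fun n => n + 2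

/-- The tree `{z | x₁, …, xₙ}`, i.e. `Cₙ` applied to `z, x₁, …, xₙ` for `n ≥ 1`, and `z` for
`n = 0`. -/
def bracket {I : Type} (z : OpTree ar I) : List (OpTree ar I) → OpTree ar I
  | [] => z
  | a :: l => .op l.length (Fin.cons z (a :: l).get)

theorem occ_bracket {I : Type} (i : I) (z : OpTree ar I) (l : List (OpTree ar I)) :
    (bracket z l).occ i = z.occ i + (l.map (OpTree.occ i)).sum := by
  cases l with
  | nil => simp [bracket]
  | cons a l =>
    simp only [bracket, OpTree.occ]
    rw [Fin.sum_univ_succ]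
    simp only [Fin.cons_zero, Fin.cons_succ]
    congr 1
    rw [← List.sum_ofFn, ← Function.comp_def, ← List.map_ofFn, List.ofFn_get]

theorem sum_block {A : Type w} {m k : ℕ} (c : A → ℕ) (y : Fin m → A) (f : Fin m → Fin k) (j : ℕ) :
    ((block y f j).map c).sum = ∑ a, if (f a : ℕ) = j then c (y a) else 0 := by
  have h : ∀ l : List (Fin m), (((l.filter fun a => (f a : ℕ) = j).map y).map c).sum =
      (l.map fun a => if (f a : ℕ) = j then c (y a) else 0).sum := by
    intro l
    induction l with
    | nil => rfl
    | cons b l ih =>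
      by_cases hb : (f b : ℕ) = j
      · simpa [List.filter_cons, hb] using ih
      · simpa [List.filter_cons, hb] using ih
  rw [block, h, ← List.ofFn_eq_map, List.sum_ofFn]

theorem occ_args {I : Type} (i : I) {n m : ℕ} (x : Fin n → OpTree ar I) (y : Fin m → OpTree ar I)
    (f : Fin m → Fin (2 * n + 1)) :
    ((braceArgs bracket x (block y f)).map (OpTree.occ i)).sum =
      ∑ a, (x a).occ i + ∑ a, (y a).occ i := by
  have h : ∀ l : List (Fin n), ((l.flatMap fun b => bracket (x b) (block y f (2 * b + 1)) ::
      block y f (2 * b + 2)).map (OpTree.occ i)).sum =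
      (l.map fun b => (x b).occ i + ∑ a, ((if (f a : ℕ) = 2 * b + 1 then (y a).occ i else 0) +
        if (f a : ℕ) = 2 * b + 2 then (y a).occ i else 0)).sum := by
    intro l
    induction l with
    | nil => rfl
    | cons b l ih =>
      rw [List.flatMap_cons, List.map_append, List.sum_append, ih, List.map_cons, List.map_cons,
        List.sum_cons, List.sum_cons, occ_bracket, sum_block, sum_block, Finset.sum_add_distrib,
        add_assoc ((x b).occ i)]
  rw [braceArgs, List.map_append, List.sum_append, h, sum_block, ← List.ofFn_eq_map,
    List.sum_ofFn, Finset.sum_add_distrib, Finset.sum_comm, add_left_comm,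
    ← Finset.sum_add_distrib]
  congr 1
  refine Finset.sum_congr rfl fun a _ => ?_
  obtain ⟨k, hk⟩ := f a
  simp only
  rcases Nat.eq_zero_or_pos k with rfl | hpos
  · simp
  · rw [if_neg (by omega), zero_add, Finset.sum_eq_single (⟨(k - 1) / 2, by omega⟩ : Fin n)]
    · dsimp only
      rcases Nat.even_or_odd' k with ⟨c, rfl | rfl⟩
      · rw [if_neg (by omega), if_pos (by omega), zero_add]
      · rw [if_pos (by omega), if_neg (by omega), add_zero]
    · intro b _ hb
      have hb' : (b : ℕ) ≠ (k - 1) / 2 := fun h => hb (Fin.ext h)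
      rw [if_neg (by omega), if_neg (by omega), add_zero]
    · simp

/-- The variables of the brace relation: `z`, `x₁, …, xₙ` and `y₁, …, yₘ`. -/
abbrev Vars (n m : ℕ) : Type := Unit ⊕ Fin n ⊕ Fin m

/-- The variable `z`. -/
def vz (n m : ℕ) : OpTree ar (Vars n m) := .var (.inl ())
/-- The variables `x`. -/
def vx (n m : ℕ) (a : Fin n) : OpTree ar (Vars n m) := .var (.inr (.inl a))
/-- The variables `y`. -/
def vy (n m : ℕ) (a : Fin m) : OpTree ar (Vars n m) := .var (.inr (.inr a))

theorem occ_vars {n m : ℕ} (i : Vars n m) :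
    (vz n m).occ i + (∑ a, (vx n m a).occ i + ∑ a, (vy n m a).occ i) = 1 := by
  rcases i with i | i | i <;> simp [vz, vx, vy, OpTree.occ]

theorem isMultilinear_LHS (n m : ℕ) :
    (braceLHS bracket (vz n m) (vx n m) (vy n m)).IsMultilinear := fun i => by
  rw [braceLHS, occ_bracket, occ_bracket, List.map_ofFn, List.map_ofFn, List.sum_ofFn,
    List.sum_ofFn, add_assoc]
  exact occ_vars i

theorem isMultilinear_RHS (n m : ℕ) (f : Fin m → Fin (2 * n + 1)) :
    (braceRHS bracket (vz n m) (vx n m) (vy n m) f).IsMultilinear := fun i => by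
  rw [braceRHS, occ_bracket, occ_args]
  exact occ_vars i

/-- The relators of `Brace`. -/
inductive Rel (R : Type u) [CommRing R] :
    ∀ (I : Type) [Finite I], (SymmOperad.free R ar).obj I → Prop
  | brace (n m : ℕ) (hn : 1 ≤ n) (hm : 1 ≤ m) : Rel R (Vars n m)
      (SymmOperad.mon R _ (isMultilinear_LHS n m) -
        ∑ f ∈ intervalPartitions n m, SymmOperad.mon R _ (isMultilinear_RHS n m f))

theorem isMultilinear_corolla (n : ℕ) :
    (bracket (.var 0 : OpTree ar (Fin (n + 1)))
      (List.ofFn fun a : Fin n => .var a.succ)).IsMultilinear := fun i => by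
  rw [occ_bracket, List.map_ofFn, List.sum_ofFn]
  have h := Fin.sum_univ_succ fun j : Fin (n + 1) => (OpTree.var j : OpTree ar (Fin (n + 1))).occ i
  refine h.symm.trans ?_
  rw [Finset.sum_eq_single i]
  · simp [OpTree.occ]
  · intro j _ hj
    simp [OpTree.occ, hj]
  · simp

end BraceOperad

/-- The operad `Brace`: the quotient of the free operad on `C₁, C₂, …` by the brace relations. -/
noncomputable def Brace (R : Type u) [CommRing R] : SymmOperad.{u, u} R :=
  (SymmOperad.free R BraceOperad.ar).quot (BraceOperad.Rel R)

/-- The corolla `Corlₙ` in `Brace(n + 1)`: the operation `{x₁ | x₂, …, xₙ₊₁}`. The input `xⱼ` is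
labelled by `j - 1 : Fin (n + 1)`. -/
noncomputable def corolla (R : Type u) [CommRing R] (n : ℕ) : (Brace R).obj (Fin (n + 1)) :=
  SymmOperad.toQuot _ _ (SymmOperad.mon R _ (BraceOperad.isMultilinear_corolla n))

/-! ### The operations `↗` and `↘` and the terms `↗ ≻ x ≺ ↘` -/

section Arrows

variable {A : Type w} (p s : A → A → A)

/-- `↗(x, y₁, …, yₙ) = x ≺ ↗(y₁, …, yₙ)` and `↗(x) = x`, where `p` is `≺`. -/
def upArrow : A → List A → A
  | x, [] => x
  | x, y :: l => p x (upArrow y l)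

/-- `↘(x, y₁, …, yₙ) = ↘(x, y₁, …, yₙ₋₁) ≻ yₙ` and `↘(x) = x`, where `s` is `≻`. -/
def downArrow (x : A) (l : List A) : A := l.foldl s x

/-- `↗(l) ≻ x`, and `x` if `l` is empty. -/
def upSucc : List A → A → A
  | [], x => x
  | y :: l, x => s (upArrow p y l) x

/-- `x ≺ ↘(l)`, and `x` if `l` is empty. -/
def precDown : A → List A → A
  | x, [] => x
  | x, y :: l => p x (downArrow s y l)

/-- `(↗(y₁, …, yₖ) ≻ z) ≺ ↘(yₖ₊₁, …, yₙ)` for the list `l = y₁, …, yₙ`. -/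
def arrowTerm (z : A) (l : List A) (k : ℕ) : A :=
  precDown p s (upSucc p s (l.take k) z) (l.drop k)

variable {p s}

theorem count_upArrow (c : A → ℕ) (hp : ∀ a b, c (p a b) = c a + c b) (x : A) (l : List A) :
    c (upArrow p x l) = c x + (l.map c).sum := by
  induction l generalizing x with
  | nil => simp [upArrow]
  | cons y l ih => simp [upArrow, hp, ih]

theorem count_downArrow (c : A → ℕ) (hs : ∀ a b, c (s a b) = c a + c b) (x : A) (l : List A) :
    c (downArrow s x l) = c x + (l.map c).sum := by
  induction l generalizing x with
  | nil => simp [downArrow]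
  | cons y l ih =>
    have := ih (s x y)
    simp only [downArrow, List.foldl_cons, List.map_cons, List.sum_cons, hs] at this ⊢
    omega

theorem count_arrowTerm (c : A → ℕ) (hp : ∀ a b, c (p a b) = c a + c b)
    (hs : ∀ a b, c (s a b) = c a + c b) (z : A) (l : List A) (k : ℕ) :
    c (arrowTerm p s z l k) = c z + (l.map c).sum := by
  have h1 : ∀ x l, c (upSucc p s l x) = (l.map c).sum + c x := by
    intro x l
    cases l with
    | nil => simp [upSucc]
    | cons y l => simp [upSucc, hs, count_upArrow c hp]
  have h2 : ∀ x l, c (precDown p s x l) = c x + (l.map c).sum := by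
    intro x l
    cases l with
    | nil => simp [precDown]
    | cons y l => simp [precDown, hp, count_downArrow c hs]
  have h3 : (l.map c).sum = ((l.take k).map c).sum + ((l.drop k).map c).sum := by
    rw [← List.sum_append, ← List.map_append, List.take_append_drop]
  rw [arrowTerm, h2, h1, h3]
  omega

end Arrows

/-! ### Dendriform algebras and the operad `Dend` -/

/-- A dendriform algebra structure on the `R`-module `W`; `prec x y` is `x ≺ y` and `succ x y` is
`x ≻ y`. -/
structure DendriformAlgebra (R : Type u) [CommRing R] (W : Type w) [AddCommGroup W]
    [Module R W] where
  prec : W →ₗ[R] W →ₗ[R] W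
  succ : W →ₗ[R] W →ₗ[R] W
  prec_prec : ∀ x y z, prec (prec x y) z = prec x (prec y z) + prec x (succ y z)
  succ_prec : ∀ x y z, prec (succ x y) z = succ x (prec y z)
  succ_succ : ∀ x y z, succ x (succ y z) = succ (succ x y) z + succ (prec x y) z

/-- The operation `∑ (-1)^k (↗(y₁, …, yₖ) ≻ z) ≺ ↘(yₖ₊₁, …, yₙ)`, `0 ≤ k ≤ n`, of a dendriform
algebra. -/
noncomputable def DendriformAlgebra.brace {R : Type u} [CommRing R] {W : Type w} [AddCommGroup W]
    [Module R W] (D : DendriformAlgebra R W) (z : W) (l : List W) : W :=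
  ∑ k ∈ Finset.range (l.length + 1),
    (-1 : R) ^ k • arrowTerm (fun a b => D.prec a b) (fun a b => D.succ a b) z l k

namespace DendOperad

/-- The generators `≺` and `≻`. -/
inductive Gen : Type
  | prec
  | succ

/-- Both generators are binary. -/
abbrev ar : Gen → ℕ := fun _ => 2

/-- The tree `a ≺ b`. -/
def prec {I : Type} (a b : OpTree ar I) : OpTree ar I := .op .prec ![a, b]
/-- The tree `a ≻ b`. -/
def succ {I : Type} (a b : OpTree ar I) : OpTree ar I := .op .succ ![a, b]

theorem occ_prec {I : Type} (i : I) (a b : OpTree ar I) :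
    (prec a b).occ i = a.occ i + b.occ i := by
  simp [prec, OpTree.occ, Fin.sum_univ_two]

theorem occ_succ {I : Type} (i : I) (a b : OpTree ar I) :
    (succ a b).occ i = a.occ i + b.occ i := by
  simp [succ, OpTree.occ, Fin.sum_univ_two]

/-- The monomial `(x g y) h z` in the variables `x, y, z` labelled `0, 1, 2`. -/
def left (g h : Gen) : OpTree ar (Fin 3) := .op h ![.op g ![.var 0, .var 1], .var 2]

/-- The monomial `x g (y h z)` in the variables `x, y, z` labelled `0, 1, 2`. -/
def right (g h : Gen) : OpTree ar (Fin 3) := .op g ![.var 0, .op h ![.var 1, .var 2]]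

theorem isMultilinear_left (g h : Gen) : (left g h).IsMultilinear := fun i => by
  fin_cases i <;> simp [left, OpTree.occ, Fin.sum_univ_two]

theorem isMultilinear_right (g h : Gen) : (right g h).IsMultilinear := fun i => by
  fin_cases i <;> simp [right, OpTree.occ, Fin.sum_univ_two]

/-- `(x g y) h z` as an element of the free operad. -/
noncomputable def l (R : Type u) [CommRing R] (g h : Gen) :
    (SymmOperad.free R ar).obj (Fin 3) :=
  SymmOperad.mon R _ (isMultilinear_left g h)

/-- `x g (y h z)` as an element of the free operad. -/
noncomputable def r (R : Type u) [CommRing R] (g h : Gen) :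
    (SymmOperad.free R ar).obj (Fin 3) :=
  SymmOperad.mon R _ (isMultilinear_right g h)

/-- The relators of `Dend`. -/
inductive Rel (R : Type u) [CommRing R] :
    ∀ (I : Type) [Finite I], (SymmOperad.free R ar).obj I → Prop
  | prec_prec : Rel R (Fin 3) (l R .prec .prec - (r R .prec .prec + r R .prec .succ))
  | succ_prec : Rel R (Fin 3) (l R .succ .prec - r R .succ .prec)
  | succ_succ : Rel R (Fin 3) (r R .succ .succ - (l R .succ .succ + l R .prec .succ))

theorem isMultilinear_arrowTerm (n k : ℕ) :
    (arrowTerm prec succ (.var 0 : OpTree ar (Fin (n + 1)))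
      (List.ofFn fun a : Fin n => .var a.succ) k).IsMultilinear := fun i => by
  rw [count_arrowTerm (OpTree.occ i) (occ_prec i) (occ_succ i), List.map_ofFn, List.sum_ofFn]
  have h := Fin.sum_univ_succ fun j : Fin (n + 1) => (OpTree.var j : OpTree ar (Fin (n + 1))).occ i
  refine h.symm.trans ?_
  rw [Finset.sum_eq_single i]
  · simp [OpTree.occ]
  · intro j _ hj
    simp [OpTree.occ, hj]
  · simp

end DendOperad

/-- The operad `Dend` of dendriform algebras, by generators and relations. -/
noncomputable def Dend (R : Type u) [CommRing R] : SymmOperad.{u, u} R :=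
  (SymmOperad.free R DendOperad.ar).quot (DendOperad.Rel R)

/-- The element of `Dend(n + 1)` given by the operation
`∑ (-1)^k (↗(x₂, …, xₖ₊₁) ≻ x₁) ≺ ↘(xₖ₊₂, …, xₙ₊₁)`, `0 ≤ k ≤ n`. The input `xⱼ` is labelled by
`j - 1 : Fin (n + 1)`. -/
noncomputable def dendCorolla (R : Type u) [CommRing R] (n : ℕ) : (Dend R).obj (Fin (n + 1)) :=
  ∑ k ∈ Finset.range (n + 1), (-1 : R) ^ k •
    (SymmOperad.toQuot _ _ (SymmOperad.mon R _ (DendOperad.isMultilinear_arrowTerm n k)) :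
      (Dend R).obj (Fin (n + 1)))

/-! Algebra. Put `a * b = a ≺ b + a ≻ b`. The dendriform axioms make `W`, under `≻` and `≺`, a left
and a right module over `(W, *)`, with commuting actions. Let `S(x₁, …, xₙ) = (-1)ⁿ ↗(x₁, …, xₙ)`,
and let the empty word act as the identity. The operation of the theorem is then `{z | l} = Σ S(l₁)
≻ z ≺ ↘(l₂)` over the deconcatenations `l = l₁ l₂`, an adjoint action. Write `x • y` for the sum of
the words `Y₀ {x₁ | Y₁} Y₂ ⋯ {xₙ | Y₂ₙ₋₁} Y₂ₙ`. The brace relation reads `{{z | x} | y} = {z | x •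
y}`: words act on the right (`convBrace_convBrace`).

Three facts give this. Deconcatenation is multiplicative for `•` (`wordSum_splitSum`). `S` is a
convolution inverse of `↘` (`splitSum_downL_upL`, `splitSum_upR_downR`), so that `Σ ↘(l₁) ≻ {z | l₂}
= z ≺ ↘(l)` and `Σ {z | l₁} ≺ S(l₂) = S(l) ≻ z`. These cancellations yield, by induction on `x`,
that `↘(x • y) = ↘(x) * ↘(y)` and `S(x • y) = S(y) * S(x)`, stated through the module actions
(`wordSum_downL`, `wordSum_downR`, `wordSum_upR_upL`).

Operads. The families natural in a labelled finite set form an algebra over an operad `P`, and an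
operation of `P` is recovered from its value on the generic families (`act_injective`). Over `Dend`
these families form a dendriform algebra, hence satisfy the brace relations; so the brace relators
die in `Dend` (`toDend_rel`), and the morphism from the free operad (`freeLift`) descends to
`Brace`. Uniqueness holds because corollas generate (`Monomial.induction`, `hom_ext_quot`). -/

/-! ### Sums over deconcatenations and the product of words -/

section Words

variable {A : Type*} {M N : Type*} [AddCommMonoid M] [AddCommMonoid N]

/-- The sum of `F l₁ l₂` over all `l₁, l₂` with `l₁ ++ l₂ = l`. -/
def splitSum : List A → (List A → List A → M) → M
  | [], F => F [] []
  | a :: l, F => F [] (a :: l) + splitSum l fun l₁ l₂ => F (a :: l₁) l₂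

theorem map_splitSum {Φ : Type*} [FunLike Φ M N] [AddMonoidHomClass Φ M N] (φ : Φ) (l : List A)
    (F : List A → List A → M) : φ (splitSum l F) = splitSum l fun a b => φ (F a b) := by
  induction l generalizing F with
  | nil => rfl
  | cons a l ih => simp only [splitSum, map_add, ih]

theorem splitSum_add (l : List A) (F G : List A → List A → M) :
    splitSum l (fun a b => F a b + G a b) = splitSum l F + splitSum l G := by
  induction l generalizing F G with
  | nil => rfl
  | cons a l ih => simp only [splitSum, ih, add_add_add_comm]

theorem splitSum_comm {B : Type*} (l : List A) (l' : List B)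
    (F : List A → List A → List B → List B → M) :
    splitSum l (fun a b => splitSum l' (F a b)) =
      splitSum l' fun c d => splitSum l fun a b => F a b c d := by
  induction l generalizing F with
  | nil => rfl
  | cons a l ih => simp only [splitSum, ih, splitSum_add]

/-- A cut of `l b w` falls either before or after `b`. -/
theorem splitSum_append_cons (l : List A) (b : A) (w : List A) (F : List A → List A → M) :
    splitSum (l ++ b :: w) F = splitSum l (fun l₁ l₂ => F l₁ (l₂ ++ b :: w)) +
      splitSum w fun w₁ w₂ => F (l ++ b :: w₁) w₂ := by
  induction l generalizing F with
  | nil => rfl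
  | cons a l ih => simp only [List.cons_append, splitSum, ih, add_assoc]

/-- Coassociativity: both sides run over the cuts of `l` into three factors. -/
theorem splitSum_assoc (l : List A) (F : List A → List A → List A → M) :
    splitSum l (fun l' c => splitSum l' fun a b => F a b c) =
      splitSum l fun a l' => splitSum l' fun b c => F a b c := by
  induction l generalizing F with
  | nil => rfl
  | cons a l ih => simp only [splitSum, splitSum_add, ih, add_assoc]

theorem splitSum_eq_sum_range (l : List A) (F : List A → List A → M) :
    splitSum l F = ∑ k ∈ Finset.range (l.length + 1), F (l.take k) (l.drop k) := by
  induction l generalizing F with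
  | nil => simp [splitSum]
  | cons a l ih =>
    rw [List.length_cons, Finset.sum_range_succ', splitSum, ih, add_comm]
    rfl

variable (br : A → List A → A)

/-- The sum of `G w` over the words `w = Y₀, {x₁ | Y₁}, Y₂, …, {xₙ | Y₂ₙ₋₁}, Y₂ₙ`, for
`Y₀ ++ ⋯ ++ Y₂ₙ = y`. -/
def wordSum : List A → List A → (List A → M) → M
  | [], y, G => G y
  | a :: x, y, G => splitSum y fun y₁ y' => splitSum y' fun y₂ y₃ =>
      wordSum x y₃ fun w => G (y₁ ++ br a y₂ :: w)

theorem map_wordSum {Φ : Type*} [FunLike Φ M N] [AddMonoidHomClass Φ M N] (φ : Φ) (x y : List A)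
    (G : List A → M) : φ (wordSum br x y G) = wordSum br x y fun w => φ (G w) := by
  induction x generalizing y G with
  | nil => rfl
  | cons a x ih => simp only [wordSum, map_splitSum, ih]

theorem wordSum_add (x y : List A) (G H : List A → M) :
    wordSum br x y (fun w => G w + H w) = wordSum br x y G + wordSum br x y H := by
  induction x generalizing y G H with
  | nil => rfl
  | cons a x ih => simp only [wordSum, ih, splitSum_add]

theorem wordSum_splitSum_comm (x y l : List A) (G : List A → List A → List A → M) :
    wordSum br x y (fun w => splitSum l (G w)) =
      splitSum l fun a b => wordSum br x y fun w => G w a b := by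
  induction l generalizing G with
  | nil => rfl
  | cons a l ih => simp only [splitSum, wordSum_add, ih]

/-- The definition peels off the first letter of `x`; here the last one is peeled off, as required
for `↘`, which grows at its right end. The factor `y₁` is absorbed by `x`, `y₂` by `a`, and `y₃` is
the remaining tail. -/
theorem wordSum_append_singleton (x : List A) (a : A) (y : List A) (G : List A → M) :
    wordSum br (x ++ [a]) y G = splitSum y fun y₁ y' => splitSum y' fun y₂ y₃ =>
      wordSum br x y₁ fun w => G (w ++ br a y₂ :: y₃) := by
  induction x generalizing y G with
  | nil => rfl
  | cons b x ih =>
    simp only [List.cons_append, wordSum, ih, List.append_assoc]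
    conv_rhs =>
      enter [2, Y, z]
      rw [splitSum_comm]
      enter [2, y₁, d]
      rw [splitSum_comm]
    rw [splitSum_assoc]
    simp only [splitSum_assoc]

/-- Deconcatenation is compatible with the product of words. -/
theorem wordSum_splitSum (x y : List A) (F : List A → List A → M) :
    wordSum br x y (fun w => splitSum w F) = splitSum x fun x₁ x₂ => splitSum y fun y₁ y₂ =>
      wordSum br x₁ y₁ fun w₁ => wordSum br x₂ y₂ fun w₂ => F w₁ w₂ := by
  induction x generalizing y F with
  | nil => rfl
  | cons a x ih =>
    simp only [splitSum, wordSum]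
    -- The word `y₁ {a | y₂} w` is cut either before the letter `{a | y₂}`, which is the case `x₁ =
    -- ∅`, or after it, where the induction hypothesis cuts `w`.
    simp only [splitSum_append_cons, wordSum_add, splitSum_add, wordSum_splitSum_comm, ih]
    congr 1
    · conv_lhs =>
        enter [2, y₁, y']
        rw [splitSum_comm]
      rw [splitSum_assoc]
    · conv_rhs =>
        enter [2, x₁, x₂]
        rw [splitSum_assoc]
        enter [2, y₁, y']
        rw [splitSum_assoc]
      rw [splitSum_comm]
      congr 1; funext y₁ y'
      rw [splitSum_comm]

end Words

/-! ### The left and right actions of `↘` and of `S = ± ↗`. -/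

namespace DendriformAlgebra

variable {R : Type*} [CommRing R] {W : Type*} [AddCommGroup W] [Module R W]
  (D : DendriformAlgebra R W)

/-- The operator `z ↦ ↘(l) ≻ z`, the identity if `l` is empty. -/
noncomputable def downL : List W → W →ₗ[R] W
  | [] => LinearMap.id
  | c :: l => D.succ (downArrow (fun a b => D.succ a b) c l)

@[simp] theorem downL_nil (z : W) : D.downL [] z = z := rfl

/-- The operator `z ↦ z ≺ ↘(l)`, the identity if `l` is empty. -/
noncomputable def downR : List W → W →ₗ[R] W
  | [] => LinearMap.id
  | c :: l => D.prec.flip (downArrow (fun a b => D.succ a b) c l)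

@[simp] theorem downR_nil (z : W) : D.downR [] z = z := rfl

/-- The element `(-1)^n ↗(x₁, …, xₙ)`. -/
noncomputable def signedUp : W → List W → W
  | c, [] => -c
  | c, d :: l => -D.prec c (signedUp d l)

/-- The operator `z ↦ (-1)^n ↗(x₁, …, xₙ) ≻ z`, the identity if `n = 0`. -/
noncomputable def upL : List W → W →ₗ[R] W
  | [] => LinearMap.id
  | c :: l => D.succ (D.signedUp c l)

/-- The operator `z ↦ z ≺ (-1)^n ↗(x₁, …, xₙ)`, the identity if `n = 0`. -/
noncomputable def upR : List W → W →ₗ[R] W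
  | [] => LinearMap.id
  | c :: l => D.prec.flip (D.signedUp c l)

theorem signedUp_eq (c : W) (l : List W) : D.signedUp c l = -D.upR l c := by
  cases l <;> rfl

/-- With `prec_mul` and `succ_prec`, this is the bimodule structure over `* = ≺ + ≻`. Working with
actions avoids a formal unit for the empty word. -/
theorem succ_mul (a b z : W) :
    D.succ (D.prec a b + D.succ a b) z = D.succ a (D.succ b z) := by
  rw [D.succ_succ, map_add, LinearMap.add_apply, add_comm]

theorem prec_mul (a b z : W) :
    D.prec z (D.prec a b + D.succ a b) = D.prec (D.prec z a) b := by
  rw [D.prec_prec, map_add]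

/-- The iterated right operation `((b ≻ y₁) ≻ ⋯) ≻ yₙ`, linear in `b`. -/
noncomputable def foldSucc : List W → W →ₗ[R] W
  | [] => LinearMap.id
  | c :: l => (foldSucc l).comp (D.succ.flip c)

theorem downArrow_eq (c : W) (l : List W) :
    downArrow (fun a b => D.succ a b) c l = D.foldSucc l c := by
  induction l generalizing c with
  | nil => rfl
  | cons d l ih => exact ih (D.succ c d)

theorem foldSucc_append (l l' : List W) (b : W) :
    D.foldSucc (l ++ l') b = D.foldSucc l' (D.foldSucc l b) := by
  induction l generalizing b with
  | nil => rfl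
  | cons d l ih => exact ih _

theorem downL_cons (c : W) (l : List W) (z : W) :
    D.downL (c :: l) z = D.succ (D.foldSucc l c) z := by
  rw [← downArrow_eq]; rfl

theorem downR_cons (c : W) (l : List W) (z : W) :
    D.downR (c :: l) z = D.prec z (D.foldSucc l c) := by
  rw [← downArrow_eq]; rfl

theorem upL_cons (c : W) (l : List W) (z : W) :
    D.upL (c :: l) z = -D.succ (D.upR l c) z := by
  rw [upL, signedUp_eq, map_neg, LinearMap.neg_apply]

theorem upR_cons (c : W) (l : List W) (z : W) :
    D.upR (c :: l) z = -D.prec z (D.upR l c) := by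
  rw [upR, signedUp_eq, LinearMap.flip_apply, map_neg]

/-- `foldSucc l' (downL l c)` is `↘(l, c, l')` read from an arbitrary letter `c`. This singles out
the letter `{a | y₂}` inside a product word. -/
theorem downL_append_cons (l : List W) (c : W) (l' : List W) (z : W) :
    D.downL (l ++ c :: l') z = D.succ (D.foldSucc l' (D.downL l c)) z := by
  cases l with
  | nil => exact D.downL_cons c l' z
  | cons d l => rw [List.cons_append, downL_cons, foldSucc_append, downL_cons]; rfl

theorem downR_append_cons (l : List W) (c : W) (l' : List W) (z : W) :
    D.downR (l ++ c :: l') z = D.prec z (D.foldSucc l' (D.downL l c)) := by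
  cases l with
  | nil => exact D.downR_cons c l' z
  | cons d l => rw [List.cons_append, downR_cons, foldSucc_append, downL_cons]; rfl

/-- The axiom `(a ≻ z) ≺ b = a ≻ (z ≺ b)` is the source of all commutations between left and right
operators. -/
theorem succ_downR (a : W) (l : List W) (z : W) :
    D.succ a (D.downR l z) = D.downR l (D.succ a z) := by
  cases l with
  | nil => rfl
  | cons c l => rw [downR_cons, downR_cons, D.succ_prec]

theorem succ_upR (a : W) (l : List W) (z : W) :
    D.succ a (D.upR l z) = D.upR l (D.succ a z) := by
  cases l with
  | nil => rfl
  | cons c l => rw [upR_cons, upR_cons, D.succ_prec, map_neg]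

theorem upL_downR (l l' : List W) (z : W) :
    D.upL l (D.downR l' z) = D.downR l' (D.upL l z) := by
  cases l with
  | nil => rfl
  | cons c l => rw [upL_cons, upL_cons, succ_downR, map_neg]

theorem downL_downR (l l' : List W) (z : W) :
    D.downL l (D.downR l' z) = D.downR l' (D.downL l z) := by
  cases l with
  | nil => rfl
  | cons c l => rw [downL_cons, downL_cons, succ_downR]

theorem upL_upR (l l' : List W) (z : W) :
    D.upL l (D.upR l' z) = D.upR l' (D.upL l z) := by
  cases l with
  | nil => rfl
  | cons c l => rw [upL_cons, upL_cons, succ_upR, map_neg]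

/-- The product `b * ↘(l)` for `* = ≺ + ≻`, and `b` if `l` is empty. -/
noncomputable def mulDown (b : W) : List W → W
  | [] => b
  | c :: l => D.prec b (D.foldSucc l c) + D.succ b (D.foldSucc l c)

/-- The product `b * (-1)^n ↗(x₁, …, xₙ)` for `* = ≺ + ≻`, and `b` if `n = 0`. -/
noncomputable def mulUp (b : W) : List W → W
  | [] => b
  | c :: l => D.prec b (-D.upR l c) + D.succ b (-D.upR l c)

/-- The product `(-1)^n ↗(x₁, …, xₙ) * b` for `* = ≺ + ≻`, and `b` if `n = 0`. -/
noncomputable def upMul : List W → W → W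
  | [], b => b
  | c :: l, b => D.prec (-D.upR l c) b + D.succ (-D.upR l c) b

theorem succ_mulDown (b : W) (l : List W) (z : W) :
    D.succ (D.mulDown b l) z = D.succ b (D.downL l z) := by
  cases l with
  | nil => rfl
  | cons c l => rw [mulDown, succ_mul, downL_cons]

theorem prec_mulDown (b : W) (l : List W) (z : W) :
    D.prec z (D.mulDown b l) = D.downR l (D.prec z b) := by
  cases l with
  | nil => rfl
  | cons c l => rw [mulDown, prec_mul, downR_cons]

theorem succ_mulUp (b : W) (l : List W) (z : W) :
    D.succ (D.mulUp b l) z = D.succ b (D.upL l z) := by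
  cases l with
  | nil => rfl
  | cons c l => rw [mulUp, succ_mul, upL_cons, map_neg, LinearMap.neg_apply]

theorem prec_mulUp (b : W) (l : List W) (z : W) :
    D.prec z (D.mulUp b l) = D.upR l (D.prec z b) := by
  cases l with
  | nil => rfl
  | cons c l => rw [mulUp, prec_mul, upR_cons, map_neg]

theorem succ_upMul (b : W) (l : List W) (z : W) :
    D.succ (D.upMul l b) z = D.upL l (D.succ b z) := by
  cases l with
  | nil => rfl
  | cons c l => rw [upMul, succ_mul, upL_cons, map_neg, LinearMap.neg_apply]

theorem prec_upMul (b : W) (l : List W) (z : W) :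
    D.prec z (D.upMul l b) = D.prec (D.upR l z) b := by
  cases l with
  | nil => rfl
  | cons c l => rw [upMul, prec_mul, upR_cons, map_neg]

/-- Telescoping, for the word `c l`: the empty prefix gives `b ≺ S(c, l) + b ≻ S(c, l)`; the other
terms sum, by induction started at `b ≻ c`, to `-(b ≻ S(c, l))`. -/
theorem splitSum_mulUp (l : List W) (b : W) :
    splitSum l (fun l₁ l₂ => D.mulUp (D.foldSucc l₁ b) l₂) = D.upR l b := by
  induction l generalizing b with
  | nil => rfl
  | cons c l ih =>
    have h := ih (D.succ b c)
    change splitSum l (fun l₁ l₂ => D.mulUp (D.foldSucc (c :: l₁) b) l₂) = _ at h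
    rw [splitSum, h, ← succ_upR, upR_cons]
    simp [mulUp, foldSucc]

/-- `↘` and `(-1)^n ↗` are convolution inverse, acting from the left. -/
theorem splitSum_downL_upL (l : List W) (z : W) :
    splitSum l (fun l₁ l₂ => D.downL l₁ (D.upL l₂ z)) = if l = [] then z else 0 := by
  cases l with
  | nil => rfl
  | cons c l =>
    -- The products `↘(c, l₁) * S(l₂)` over the nonempty prefixes sum to `-S(c, l)`, cancelling the
    -- term of the empty prefix.
    have h := congrArg (fun a => D.succ.flip z a) (D.splitSum_mulUp l c)
    simp only [map_splitSum, LinearMap.flip_apply, succ_mulUp] at h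
    simp [splitSum, downL_cons, h, upL_cons]

/-- `↘` and `(-1)^n ↗` are convolution inverse, acting from the right. -/
theorem splitSum_upR_downR (l : List W) (z : W) :
    splitSum l (fun l₁ l₂ => D.upR l₂ (D.downR l₁ z)) = if l = [] then z else 0 := by
  cases l with
  | nil => rfl
  | cons c l =>
    have h := congrArg (fun a => D.prec z a) (D.splitSum_mulUp l c)
    simp only [map_splitSum, prec_mulUp] at h
    simp [splitSum, downR_cons, h, upR_cons]

theorem splitSum_ite (l : List W) (F : List W → W) :
    splitSum l (fun l₁ l₂ => if l₂ = [] then F l₁ else 0) = F l := by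
  induction l generalizing F with
  | nil => rfl
  | cons c l ih => rw [splitSum, ih fun l => F (c :: l)]; simp

theorem splitSum_ite' (l : List W) (F : List W → W) :
    splitSum l (fun l₁ l₂ => if l₁ = [] then F l₂ else 0) = F l := by
  cases l with
  | nil => rfl
  | cons c l =>
    have h : splitSum l (fun _ _ => (0 : W)) = 0 := by
      induction l with
      | nil => rfl
      | cons c l ih => simp [splitSum, ih]
    simp [splitSum, h]

/-! ### The adjoint action and the brace relation. -/

/-- The brace operation as a convolution product. -/
noncomputable def convBrace (z : W) (l : List W) : W :=
  splitSum l fun l₁ l₂ => D.upL l₁ (D.downR l₂ z)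

/-- The added left factor `↘` cancels the factor `S` of the adjoint action; only the right action of
`↘` remains. -/
theorem splitSum_downL_convBrace (l : List W) (z : W) :
    splitSum l (fun l₁ l₂ => D.downL l₁ (D.convBrace z l₂)) = D.downR l z := by
  simp only [convBrace, map_splitSum]
  rw [← splitSum_assoc]
  simp only [splitSum_downL_upL]
  exact splitSum_ite' l fun l => D.downR l z

/-- Mirror image: a right factor `S` cancels the factor `↘`. -/
theorem splitSum_upR_convBrace (l : List W) (z : W) :
    splitSum l (fun l₁ l₂ => D.upR l₂ (D.convBrace z l₁)) = D.upL l z := by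
  simp only [convBrace, map_splitSum]
  rw [splitSum_assoc]
  simp only [← upL_upR, ← map_splitSum, splitSum_upR_downR]
  simp only [apply_ite, map_zero]
  exact splitSum_ite l fun l => D.upL l z

/-- Recursion on the last letter `c`: if it belongs to `l₂`, induction gives `(b * ↘(l)) ≻ c = b ≻
↘(l, c)`; if `l₂` is empty, the term is `b ≺ ↘(l, c)`. -/
theorem splitSum_foldSucc_downR (l : List W) (b : W) :
    splitSum l (fun l₁ l₂ => D.foldSucc l₂ (D.downR l₁ b)) = D.mulDown b l := by
  induction l using List.reverseRecOn with
  | nil => rfl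
  | append_singleton l c ih =>
    rw [splitSum_append_cons]
    have h : ∀ l₂ u, D.foldSucc (l₂ ++ [c]) u = D.succ.flip c (D.foldSucc l₂ u) := fun l₂ u =>
      D.foldSucc_append l₂ [c] u
    simp only [h, ← map_splitSum, ih, splitSum]
    rw [LinearMap.flip_apply, succ_mulDown, add_comm]
    cases l with
    | nil => rfl
    | cons d l =>
      rw [List.cons_append, downR_cons, mulDown, h, downL_cons]; rfl

/-- The iterated left operation `-x₁ ≺ (-x₂ ≺ ⋯ (-xₙ ≺ b))`, linear in `b`. -/
noncomputable def foldPrec : List W → W →ₗ[R] W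
  | [] => LinearMap.id
  | c :: l => -(D.prec c).comp (foldPrec l)

/-- Reading from an arbitrary letter, for `S`: `S(l, c, l') = -foldPrec l (upR l' c)`. -/
theorem upR_append_cons (l : List W) (c : W) (l' : List W) (z : W) :
    D.upR (l ++ c :: l') z = -D.prec z (D.foldPrec l (D.upR l' c)) := by
  induction l generalizing z with
  | nil => exact D.upR_cons c l' z
  | cons d l ih => rw [List.cons_append, upR_cons, ih]; rfl

theorem upL_append_cons (l : List W) (c : W) (l' : List W) (z : W) :
    D.upL (l ++ c :: l') z = -D.succ (D.foldPrec l (D.upR l' c)) z := by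
  cases l with
  | nil => exact D.upL_cons c l' z
  | cons d l => rw [List.cons_append, upL_cons, upR_append_cons]; rfl

/-- Recursion on the first letter: `l₁ = ∅` gives `S(c, l) ≻ b`, and the other terms give `-c ≺
(S(l) * b) = S(c, l) ≺ b`. -/
theorem splitSum_foldPrec_upL (l : List W) (b : W) :
    splitSum l (fun l₁ l₂ => D.foldPrec l₁ (D.upL l₂ b)) = D.upMul l b := by
  induction l with
  | nil => rfl
  | cons c l ih =>
    have h : ∀ l₁ u, D.foldPrec (c :: l₁) u = -D.prec c (D.foldPrec l₁ u) := fun l₁ u => rfl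
    simp only [splitSum, h]
    have h' := map_splitSum (-D.prec c) l fun l₁ l₂ => D.foldPrec l₁ (D.upL l₂ b)
    simp only [LinearMap.neg_apply] at h'
    rw [← h', ih, prec_upMul, upMul, upL_cons, map_neg, add_comm, map_neg,
      LinearMap.neg_apply, map_neg, LinearMap.neg_apply]
    rfl

/-- Induction step for `↘((x a) • y) = ↘(x, a) * ↘(y)`, shared by both actions through `H`. For `y =
y₁ y₂ y₃`, the prefix acts as `↘(x)` after `↘(y₁)` by `hx`; the sum of `↘(y₁) ≻ {a | y₂}` becomes a
right action of `↘` on `a`, and the fold over `y₃` completes the product with `↘(y)`. -/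
theorem wordSum_append_singleton' (x : List W) (a : W) (y : List W) (H : W →ₗ[R] W)
    (hx : ∀ y z, wordSum D.convBrace x y (fun w => D.downL w z) = D.downL x (D.downL y z))
    {G : List W → W} (hG : ∀ l c l', G (l ++ c :: l') = H (D.foldSucc l' (D.downL l c))) :
    wordSum D.convBrace (x ++ [a]) y G = H (D.mulDown (D.downL x a) y) := by
  rw [wordSum_append_singleton]
  simp only [hG, ← map_wordSum, hx, ← map_splitSum]
  rw [← splitSum_assoc]
  simp only [← map_splitSum, splitSum_downL_convBrace, downL_downR, splitSum_foldSucc_downR]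

/-- Mirror step for `S((a x) • y) = S(y) * S(a, x)`, with the first letter split off: now `S(y₃)`
cancels against `{a | y₂}` and `y₁` completes the product. The sign is left to `H`. -/
theorem wordSum_cons' (x : List W) (a : W) (y : List W)
    (hx : ∀ y z, wordSum D.convBrace x y (fun w => D.upR w z) = D.upR x (D.upR y z))
    (H : W →ₗ[R] W) {G : List W → W}
    (hG : ∀ l c l', G (l ++ c :: l') = H (D.foldPrec l (D.upR l' c))) :
    wordSum D.convBrace (a :: x) y G = H (D.upMul y (D.upR x a)) := by
  simp only [wordSum, hG, ← map_wordSum, hx, ← map_splitSum]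
  simp only [splitSum_upR_convBrace, ← upL_upR, splitSum_foldPrec_upL]

theorem wordSum_downL (x y : List W) (z : W) :
    wordSum D.convBrace x y (fun w => D.downL w z) = D.downL x (D.downL y z) := by
  induction x using List.reverseRecOn generalizing y z with
  | nil => rfl
  | append_singleton x a ih =>
    rw [D.wordSum_append_singleton' x a y (D.succ.flip z) ih (fun l c l' => by
      rw [downL_append_cons]; rfl)]
    rw [LinearMap.flip_apply, succ_mulDown, downL_append_cons]
    rfl

theorem wordSum_downR (x y : List W) (z : W) :
    wordSum D.convBrace x y (fun w => D.downR w z) = D.downR y (D.downR x z) := by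
  induction x using List.reverseRecOn with
  | nil => rfl
  | append_singleton x a ih =>
    rw [D.wordSum_append_singleton' x a y (D.prec z) (D.wordSum_downL x) (fun l c l' => by
      rw [downR_append_cons])]
    rw [prec_mulDown, downR_append_cons]
    rfl

/-- The first half at `x` is the inductive input for both halves at `a :: x`. -/
theorem wordSum_upR_upL (x y : List W) (z : W) :
    wordSum D.convBrace x y (fun w => D.upR w z) = D.upR x (D.upR y z) ∧
    wordSum D.convBrace x y (fun w => D.upL w z) = D.upL y (D.upL x z) := by
  induction x generalizing y z with
  | nil => exact ⟨rfl, rfl⟩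
  | cons a x ih =>
    constructor
    · rw [D.wordSum_cons' x a y (fun y u => (ih y u).1) (-D.prec z) fun l c l' => by
        rw [upR_append_cons, LinearMap.neg_apply]]
      rw [LinearMap.neg_apply, prec_upMul, upR_cons]
    · rw [D.wordSum_cons' x a y (fun y u => (ih y u).1) (-D.succ.flip z) fun l c l' => by
        rw [upL_append_cons, LinearMap.neg_apply, LinearMap.flip_apply]]
      rw [LinearMap.neg_apply, LinearMap.flip_apply, succ_upMul, upL_cons, map_neg]

/-- The convolution of two commuting right actions of a bialgebra is a right action: after splitting
the product word, it remains to move `S(x₁)` past `↘(y₂)`. -/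
theorem convBrace_convBrace (z : W) (x y : List W) :
    D.convBrace (D.convBrace z x) y = wordSum D.convBrace x y (D.convBrace z) := by
  have h : D.convBrace z = fun w => splitSum w fun l₁ l₂ => D.upL l₁ (D.downR l₂ z) := rfl
  rw [h, wordSum_splitSum]
  simp only [← map_wordSum, wordSum_downR, (D.wordSum_upR_upL _ _ _).2]
  rw [splitSum_comm]
  simp only [convBrace, map_splitSum, upL_downR]

end DendriformAlgebra

/-! ### Sums over interval partitions -/

section Blocks

variable {A : Type*} {M : Type*} [AddCommMonoid M]

/-- The sequence `l, Y 0, Y 1, …`. -/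
def consSeq (l : List A) (Y : ℕ → List A) : ℕ → List A
  | 0 => l
  | j + 1 => Y j

/-- The sum of `G (Y₀, …, Yₖ₋₁, ∅, ∅, …)` over `Y₀ ++ ⋯ ++ Yₖ₋₁ = l`. -/
def blockSum : ℕ → List A → ((ℕ → List A) → M) → M
  | 0, [], G => G fun _ => []
  | 0, _ :: _, _ => 0
  | K + 1, l, G => splitSum l fun l₁ l₂ => blockSum K l₂ fun Y => G (consSeq l₁ Y)

theorem blockSum_succ (K : ℕ) (l : List A) (G : (ℕ → List A) → M) :
    blockSum (K + 1) l G =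
      splitSum l fun l₁ l₂ => blockSum K l₂ fun Y => G (consSeq l₁ Y) := by
  cases l <;> rfl

theorem block_cons_zero {m K : ℕ} (y : Fin (m + 1) → A) (f : Fin m → Fin (K + 1)) :
    block y (Fin.cons 0 f : Fin (m + 1) → Fin (K + 1)) =
      consSeq (y 0 :: block (Fin.tail y) f 0) fun j => block (Fin.tail y) f (j + 1) := by
  funext j
  cases j <;> simp [block, consSeq, List.finRange_succ, List.filter_map, Function.comp_def,
    Fin.tail]

theorem block_succ {m K : ℕ} (y : Fin m → A) (f : Fin m → Fin K) :
    block y (fun a => (f a).succ) = consSeq [] (block y f) := by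
  funext j
  cases j <;> simp [block, consSeq]

-- A weakly increasing `f` either sends `0` to `0`, with an arbitrary weakly increasing tail, or
-- never takes the value `0`. These are the two cases of `splitSum`: the first letter lies in the
-- first block, or that block is empty.
open Classical in
theorem sum_monotone_succ {m K : ℕ} (φ : (Fin (m + 1) → Fin (K + 1)) → M) :
    ∑ f with Monotone f, φ f = ∑ f : Fin m → Fin (K + 1) with Monotone f, φ (Fin.cons 0 f) +
      ∑ f : Fin (m + 1) → Fin K with Monotone f, φ fun a => (f a).succ := by
  rw [← Finset.sum_filter_add_sum_filter_not (Finset.univ.filter Monotone) fun f => f 0 = 0]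
  congr 1
  · refine Finset.sum_nbij' (fun f => Fin.tail f) (fun f => Fin.cons 0 f) ?_ ?_ ?_ ?_ ?_
    · intro f hf
      simp only [Finset.mem_filter, Finset.mem_univ, true_and] at hf ⊢
      exact fun a b hab => hf.1 (Fin.succ_le_succ_iff.2 hab)
    · intro f hf
      simp only [Finset.mem_filter, Finset.mem_univ, true_and] at hf ⊢
      refine ⟨fun a b hab => ?_, rfl⟩
      induction a using Fin.cases with
      | zero => exact Fin.zero_le _
      | succ a =>
        induction b using Fin.cases with
        | zero => exact absurd hab (by simp)
        | succ b => exact hf (Fin.succ_le_succ_iff.1 hab)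
    · intro f hf
      simp only [Finset.mem_filter] at hf
      rw [← hf.2, Fin.cons_self_tail]
    · intro f _
      exact Fin.tail_cons _ _
    · intro f hf
      simp only [Finset.mem_filter] at hf
      rw [← hf.2, Fin.cons_self_tail]
  · refine (Finset.sum_bij (fun f _ => fun a => (f a).succ) ?_ ?_ ?_ ?_).symm
    · intro f hf
      simp only [Finset.mem_filter, Finset.mem_univ, true_and] at hf ⊢
      exact ⟨fun a b hab => Fin.succ_le_succ_iff.2 (hf hab), Fin.succ_ne_zero _⟩
    · intro f _ g _ h
      funext a
      exact Fin.succ_injective _ (congrFun h a)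
    · intro f hf
      simp only [Finset.mem_filter, Finset.mem_univ, true_and] at hf ⊢
      have h0 : ∀ a, f a ≠ 0 := fun a ha =>
        hf.2 (le_antisymm (ha ▸ hf.1 (Fin.zero_le a)) (Fin.zero_le _))
      refine ⟨fun a => (f a).pred (h0 a), fun a b hab => ?_, funext fun a => Fin.succ_pred _ _⟩
      exact Fin.pred_le_pred_iff.2 (hf.1 hab)
    · intro f _
      rfl

open Classical in
theorem sum_monotone_block {m K : ℕ} (y : Fin m → A) (G : (ℕ → List A) → M) :
    ∑ f : Fin m → Fin K with Monotone f, G (block y f) = blockSum K (List.ofFn y) G := by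
  have h0 : ∀ (K : ℕ) (y : Fin 0 → A) (G : (ℕ → List A) → M),
      ∑ f : Fin 0 → Fin K with Monotone f, G (block y f) = G fun _ => [] := by
    intro K y G
    rw [Finset.filter_true_of_mem fun f _ a => a.elim0]
    simp only [Finset.univ_unique, Finset.sum_singleton]
    rfl
  induction K generalizing m G with
  | zero =>
    cases m with
    | zero => rw [h0]; rfl
    | succ m => simp [blockSum]
  | succ K ihK =>
    induction m generalizing G with
    | zero =>
      rw [h0, List.ofFn_zero, blockSum, splitSum]
      have h := (h0 K y fun Y => G (consSeq [] Y)).symm.trans (ihK y fun Y => G (consSeq [] Y))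
      rw [List.ofFn_zero] at h
      refine Eq.trans ?_ h
      congr 1
      funext j
      cases j <;> rfl
    | succ m ihm =>
      -- First letter in block `0`: induction on the number of letters. Block `0` empty: induction
      -- on the number of blocks.
      rw [sum_monotone_succ]
      simp only [block_cons_zero, block_succ]
      rw [ihK y fun Y => G (consSeq [] Y), ihm (Fin.tail y) fun Y =>
        G (consSeq (y 0 :: Y 0) fun j => Y (j + 1)), List.ofFn_succ, blockSum, blockSum, splitSum,
        add_comm]
      rfl

theorem braceArgs_succ (br : A → List A → A) {n : ℕ} (x : Fin (n + 1) → A) (Y₀ Y₁ : List A)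
    (Y : ℕ → List A) : braceArgs br x (consSeq Y₀ (consSeq Y₁ Y)) =
      Y₀ ++ br (x 0) Y₁ :: braceArgs br (Fin.tail x) Y := by
  simp [braceArgs, List.finRange_succ, List.flatMap_map, consSeq, Fin.tail, mul_add]

/-- Each `xᵢ` uses two blocks, the one before it and its arguments, so the induction removes two of
the `2n + 1` blocks at a time; for `n = 0` the single block is all of `y`. -/
theorem blockSum_braceArgs (br : A → List A → A) {n : ℕ} (x : Fin n → A) (y : List A)
    (G : List A → M) : blockSum (2 * n + 1) y (fun Y => G (braceArgs br x Y)) =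
      wordSum br (List.ofFn x) y G := by
  induction n generalizing y G with
  | zero =>
    have h : ∀ (l : List A) (F : List A → M),
        (splitSum l fun l₁ l₂ => blockSum 0 l₂ fun _ => F l₁) = F l := by
      intro l
      induction l with
      | nil => exact fun F => rfl
      | cons a l ih => exact fun F => by rw [splitSum, ih fun l => F (a :: l)]; simp [blockSum]
    simpa [braceArgs, consSeq, wordSum, blockSum] using h y G
  | succ n ih =>
    rw [List.ofFn_succ, wordSum, show 2 * (n + 1) + 1 = 2 * n + 1 + 1 + 1 by ring]
    simp only [blockSum_succ (2 * n + 1 + 1), blockSum_succ (2 * n + 1), braceArgs_succ]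
    congr 1; funext y₁ y'; congr 1; funext y₂ y₃
    exact ih (Fin.tail x) y₃ fun w => G (y₁ ++ br (x 0) y₂ :: w)

theorem sum_intervalPartitions (br : A → List A → A) {n m : ℕ} (x : Fin n → A) (y : Fin m → A)
    (G : List A → M) : ∑ f ∈ intervalPartitions n m, G (braceArgs br x (block y f)) =
      wordSum br (List.ofFn x) (List.ofFn y) G := by
  classical
  rw [← blockSum_braceArgs, ← sum_monotone_block]
  exact Finset.sum_congr (by ext; simp [intervalPartitions]) fun _ _ => rfl

end Blocks

/-! ### The signed arrow sum is the adjoint action. -/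

namespace DendriformAlgebra

variable {R : Type*} [CommRing R] {W : Type*} [AddCommGroup W] [Module R W]
  (D : DendriformAlgebra R W)

theorem upL_eq_smul (l : List W) (z : W) : D.upL l z =
    (-1 : R) ^ l.length • upSucc (fun a b => D.prec a b) (fun a b => D.succ a b) l z := by
  have h : ∀ c l, D.signedUp c l =
      (-1 : R) ^ (l.length + 1) • upArrow (fun a b => D.prec a b) c l := by
    intro c l
    induction l generalizing c with
    | nil => simp [signedUp, upArrow]
    | cons d l ih => simp [signedUp, upArrow, ih, pow_succ]
  cases l with
  | nil => simp [upL, upSucc]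
  | cons c l => simp [upL, upSucc, h]

theorem downR_eq (l : List W) (z : W) :
    D.downR l z = precDown (fun a b => D.prec a b) (fun a b => D.succ a b) z l := by
  cases l <;> rfl

theorem brace_eq_convBrace : D.brace = D.convBrace := by
  funext z l
  rw [brace, convBrace, splitSum_eq_sum_range]
  refine Finset.sum_congr rfl fun k hk => ?_
  have hk : k ≤ l.length := Nat.lt_succ_iff.1 (Finset.mem_range.1 hk)
  rw [upL_downR, upL_eq_smul, map_smul, downR_eq, List.length_take, min_eq_left hk]
  rfl

theorem brace_nil (z : W) : D.brace z [] = z := by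
  rw [brace_eq_convBrace]
  rfl

theorem brace_rel {n m : ℕ} (z : W) (x : Fin n → W) (y : Fin m → W) :
    braceLHS D.brace z x y = ∑ f ∈ intervalPartitions n m, braceRHS D.brace z x y f := by
  simp only [braceLHS, braceRHS]
  rw [sum_intervalPartitions D.brace x y (D.brace z), brace_eq_convBrace, convBrace_convBrace]

end DendriformAlgebra

/-! ### Evaluation of trees and induction on monomials -/

namespace OpTree

variable {G : Type} {ar : G → ℕ} {I J : Type} {A : Type*}

/-- The value of a tree for given operations `o g` and values of the leaves. -/
def eval (o : ∀ g, (Fin (ar g) → A) → A) (v : I → A) : OpTree ar I → A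
  | var i => v i
  | op g a => o g fun k => eval o v (a k)

variable (o : ∀ g, (Fin (ar g) → A) → A)

theorem eval_bind (f : I → OpTree ar J) (v : J → A) (t : OpTree ar I) :
    (t.bind f).eval o v = t.eval o fun i => (f i).eval o v := by
  induction t with
  | var i => rfl
  | op g a ih => simp only [bind, eval, ih]

theorem eval_map (f : I → J) (v : J → A) (t : OpTree ar I) :
    (t.map f).eval o v = t.eval o fun i => v (f i) :=
  eval_bind o _ v t

theorem eval_graft {J : I → Type} (t : OpTree ar I) (s : ∀ i, OpTree ar (J i))
    (v : (Σ i, J i) → A) :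
    (t.graft s).eval o v = t.eval o fun i => (s i).eval o fun j => v ⟨i, j⟩ := by
  simp only [graft, eval_bind, eval_map]

/-- The tree with the single vertex `g`. -/
def corolla (g : G) : OpTree ar (Fin (ar g)) := op g var

theorem isMultilinear_corolla (g : G) : (corolla g : OpTree ar _).IsMultilinear := fun i => by
  simp only [corolla, occ]
  rw [Finset.sum_eq_single i]
  · exact if_pos rfl
  · exact fun k _ hk => if_neg hk
  · simp

/-- Serves to restrict each child of a monomial to the labels it contains. -/
theorem exists_map_val (t : OpTree ar I) (p : I → Prop) (h : ∀ i, t.occ i ≠ 0 → p i) :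
    ∃ b : OpTree ar {i // p i}, b.map Subtype.val = t := by
  induction t with
  | var i => exact ⟨var ⟨i, h i (by simp [occ])⟩, rfl⟩
  | op g a ih =>
    have h' : ∀ k, ∃ b : OpTree ar {i // p i}, b.map Subtype.val = a k := fun k =>
      ih k fun i hi => h i fun h0 => hi (by
        rw [occ, Finset.sum_eq_zero_iff] at h0
        exact h0 k (Finset.mem_univ k))
    choose b hb using h'
    exact ⟨op g b, by simp only [map, bind] at hb ⊢; simp only [hb]⟩

theorem eval_congr (t : OpTree ar I) (v v' : I → A) (h : ∀ i, t.occ i ≠ 0 → v i = v' i) :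
    t.eval o v = t.eval o v' := by
  obtain ⟨b, hb⟩ := t.exists_map_val (fun i => t.occ i ≠ 0) fun i hi => hi
  rw [← hb, eval_map, eval_map]
  exact congrArg (fun w => b.eval o w) (funext fun i => h i.1 i.2)

end OpTree

namespace Monomial

variable {G : Type} {ar : G → ℕ}

/-- The monomial with the single vertex `g`. -/
def corolla (g : G) : Monomial ar (Fin (ar g)) :=
  ⟨OpTree.corolla g, OpTree.isMultilinear_corolla g⟩

/-- Each label occurs once in total, so the label sets of the children partition `I` and each child
is multilinear over its own labels. The maps `f k` remember the original subtrees, for structural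
induction. -/
theorem exists_relabel_graft {I : Type} [Finite I] (g : G) (a : Fin (ar g) → OpTree ar I)
    (ha : (OpTree.op g a).IsMultilinear) :
    ∃ (J : Fin (ar g) → Type) (_ : ∀ k, Finite (J k)) (f : ∀ k, J k → I)
      (s : ∀ k, Monomial ar (J k)) (e : (Σ k, J k) ≃ I),
      (∀ k, (s k).1.map (f k) = a k) ∧
        (⟨OpTree.op g a, ha⟩ : Monomial ar I) = ((corolla g).graft s).relabel e := by
  choose b hb using fun k => (a k).exists_map_val (fun i => (a k).occ i ≠ 0) fun i hi => hi
  have hs : ∀ i, ∑ k, (a k).occ i = 1 := ha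
  have hle : ∀ k i, (a k).occ i ≤ 1 := fun k i => by
    rw [← hs i]
    exact Finset.single_le_sum (f := fun k => (a k).occ i) (fun _ _ => Nat.zero_le _)
      (Finset.mem_univ k)
  have hmul : ∀ k, (b k).IsMultilinear := fun k i => by
    rw [← OpTree.occ_map_of_injective Subtype.val_injective, hb]
    have := hle k i
    have := i.2
    omega
  have hbij : Function.Bijective fun p : Σ k, {i // (a k).occ i ≠ 0} => p.2.1 := by
    constructor
    · rintro ⟨k, i, hi⟩ ⟨k', i', hi'⟩ h
      obtain rfl : i = i' := h
      by_cases hk : k = k'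
      · subst hk; rfl
      · have h2 := Finset.sum_le_sum_of_subset (f := fun k => (a k).occ i)
          (Finset.subset_univ {k, k'})
        rw [Finset.sum_pair hk, hs] at h2
        omega
    · intro i
      obtain ⟨k, _, hk⟩ := Finset.exists_ne_zero_of_sum_ne_zero
        (s := Finset.univ) (f := fun k => (a k).occ i) (by rw [hs]; exact one_ne_zero)
      exact ⟨⟨k, i, hk⟩, rfl⟩
  refine ⟨fun k => {i // (a k).occ i ≠ 0}, fun k => inferInstance, fun k => Subtype.val,
    fun k => ⟨b k, hmul k⟩, Equiv.ofBijective _ hbij, hb, Subtype.ext ?_⟩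
  simp only [relabel, graft, corolla, OpTree.corolla, OpTree.graft, OpTree.map, OpTree.bind,
    OpTree.bind_bind]
  congr 1
  funext k
  exact (hb k).symm

/-- Every monomial is obtained from the unit and the corollas by grafting and relabelling. -/
theorem induction {Q : ∀ (I : Type) [Finite I], Monomial ar I → Prop}
    (unit : Q Unit unit)
    (relabel : ∀ {I J : Type} [Finite I] [Finite J] (e : I ≃ J) (t : Monomial ar I),
      Q I t → Q J (t.relabel e))
    (graft : ∀ (g : G) {J : Fin (ar g) → Type} [∀ k, Finite (J k)] (s : ∀ k, Monomial ar (J k)),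
      (∀ k, Q (J k) (s k)) → Q (Σ k, J k) ((corolla g).graft s))
    {I : Type} [Finite I] (t : Monomial ar I) : Q I t := by
  -- Restricting a child changes its label type, so the induction runs on a tree over a fixed `L`,
  -- for all monomials mapping to it.
  have key : ∀ {L : Type} (t : OpTree ar L) (I : Type) [Finite I] (m : Monomial ar I) (f : I → L),
      m.1.map f = t → Q I m := by
    intro L t
    induction t with
    | var l =>
      rintro I _ ⟨m, hm⟩ f h
      cases m with
      | op g a => cases h
      | var i =>
        have hi : ∀ j, i = j := fun j => by
          have := hm j
          by_contra hij
          simp [OpTree.occ, hij] at this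
        let e : Unit ≃ I := ⟨fun _ => i, fun _ => (), fun _ => rfl, hi⟩
        exact relabel e Monomial.unit unit
    | op g a ih =>
      rintro I _ ⟨m, hm⟩ f h
      cases m with
      | var i => cases h
      | op g' a' =>
        simp only [OpTree.map, OpTree.bind, OpTree.op.injEq] at h
        obtain ⟨rfl, h⟩ := h
        obtain ⟨J, _, f', s, e, hs, he⟩ := exists_relabel_graft _ a' hm
        rw [he]
        refine relabel e _ (graft _ s fun k => ih k (J k) (s k) (fun j => f (f' k j)) ?_)
        rw [← congrFun (eq_of_heq h) k, ← hs k]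
        simp only [OpTree.map, OpTree.bind_bind, OpTree.bind]
  exact key t.1 I t id (OpTree.bind_var _)

end Monomial

/-! ### Natural families and the algebra they form over an operad -/

namespace SymmOperad

variable {R : Type u} [CommRing R] (P : SymmOperad.{u, v} R)

/-- A finite set labelled by `I`. -/
structure Labelled (I : Type) where
  /-- the finite set -/
  S : Type
  [fin : Finite S]
  /-- the labelling -/
  lab : S → I

attribute [instance] Labelled.fin

/-- The families of elements of `P(S)`, for all finite sets `S` labelled by `I`, compatible with
bijections. -/
def Fam (I : Type) : Submodule R (∀ x : Labelled I, P.obj x.S) where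
  carrier := {a | ∀ (x y : Labelled I) (e : x.S ≃ y.S), (∀ s, y.lab (e s) = x.lab s) →
    P.map e (a x) = a y}
  zero_mem' := fun x y e _ => map_zero _
  add_mem' := fun {a b} ha hb x y e h => by
    simp only [Pi.add_apply, map_add, ha x y e h, hb x y e h]
  smul_mem' := fun c a ha x y e h => by
    simp only [Pi.smul_apply, map_smul, ha x y e h]

variable {P}

/-- The component of a family at a labelled finite set, as a linear map. -/
def famAt {I S : Type} [Finite S] (l : S → I) : P.Fam I →ₗ[R] P.obj S :=
  (LinearMap.proj (φ := fun x : Labelled I => P.obj x.S) ⟨S, l⟩).comp (P.Fam I).subtype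

theorem map_famAt {I : Type} (a : P.Fam I) {S T : Type} [Finite S] [Finite T] (e : S ≃ T)
    (l : S → I) (l' : T → I) (h : ∀ s, l' (e s) = l s) :
    P.map e (famAt l a) = famAt l' a :=
  a.2 ⟨S, l⟩ ⟨T, l'⟩ e h

theorem fam_ext {I : Type} {a b : P.Fam I}
    (h : ∀ (S : Type) [Finite S] (l : S → I), famAt l a = famAt l b) : a = b :=
  Subtype.ext (funext fun x => h x.S x.lab)

/-- The summand at `f` of the value of an operation on families. -/
def actTerm {K I S : Type} [Finite K] [Finite S] (p : P.obj K) (l : S → I) (f : S → K) :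
    MultilinearMap R (fun _ : K => P.Fam I) (P.obj S) :=
  (P.map (Equiv.sigmaFiberEquiv f)).compMultilinearMap
    ((P.comp p).compLinearMap fun k => famAt fun s : {s // f s = k} => l s)

theorem actTerm_apply {K I S : Type} [Finite K] [Finite S] (p : P.obj K) (l : S → I) (f : S → K)
    (w : K → P.Fam I) : actTerm p l f w = P.map (Equiv.sigmaFiberEquiv f)
      (P.comp p fun k => famAt (fun s : {s // f s = k} => l s) (w k)) := rfl

/-- A bijection carries the fibres of `f` to those of `f ∘ e⁻¹`; hence the sum over all `f` is
natural. -/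
theorem map_actTerm {K I S T : Type} [Finite K] [Finite S] [Finite T] (p : P.obj K)
    (w : K → P.Fam I) (e : S ≃ T) (l : S → I) (l' : T → I) (h : ∀ s, l' (e s) = l s)
    (f : S → K) : P.map e (actTerm p l f w) = actTerm p l' (f ∘ e.symm) w := by
  have h1 : ∀ k, famAt (fun t : {t // (f ∘ e.symm) t = k} => l' t) (w k) =
      P.map (e.subtypeEquiv fun s => by simp) (famAt (fun s : {s // f s = k} => l s) (w k)) :=
    fun k => (map_famAt (w k) (e.subtypeEquiv _) _ _ fun s => h s.1).symm
  simp only [actTerm_apply, h1]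
  rw [comp_map_right, ← map_trans, ← map_trans]
  rfl

attribute [local instance] Fintype.ofFinite

/-- The value of an operation on families. -/
noncomputable def act {K : Type} [Finite K] (I : Type) (p : P.obj K) :
    MultilinearMap R (fun _ : K => P.Fam I) (P.Fam I) where
  toFun w := ⟨fun x => ∑ f, actTerm p x.lab f w, fun x y e h => by
      simp only [map_sum, map_actTerm p w e _ _ h]
      exact Fintype.sum_equiv (e.arrowCongr (Equiv.refl K)) _ _ fun f => rfl⟩
  map_update_add' w k a b := Subtype.ext <| funext fun x => by
    simp only [MultilinearMap.map_update_add, Finset.sum_add_distrib]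
    rfl
  map_update_smul' w k c a := Subtype.ext <| funext fun x => by
    simp only [MultilinearMap.map_update_smul, ← Finset.smul_sum]
    rfl

theorem famAt_act {K I S : Type} [Finite K] [Finite S] (p : P.obj K) (w : K → P.Fam I)
    (l : S → I) : famAt l (act I p w) = ∑ f, actTerm p l f w := rfl

/-- `act` as a linear map in the operation. -/
noncomputable def actHom {K : Type} [Finite K] {I : Type} (w : K → P.Fam I) :
    P.obj K →ₗ[R] P.Fam I where
  toFun p := act I p w
  map_add' p q := fam_ext fun S _ l => by
    simp [famAt_act, actTerm_apply, Finset.sum_add_distrib]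
  map_smul' c p := fam_ext fun S _ l => by
    simp [famAt_act, actTerm_apply, Finset.smul_sum]

theorem actHom_apply {K : Type} [Finite K] {I : Type} (w : K → P.Fam I) (p : P.obj K) :
    actHom w p = act I p w := rfl

theorem act_one {I : Type} (w : Unit → P.Fam I) : act I P.one w = w () := fam_ext fun S _ l => by
  rw [famAt_act, Fintype.sum_eq_single (fun _ => ()) fun f hf => absurd (Subsingleton.elim _ _) hf,
    actTerm_apply]
  have h : ∀ k : Unit, famAt (fun s : {s : S // () = k} => l s) (w k) =
      P.map (Equiv.subtypeUnivEquiv fun _ => rfl).symm (famAt l (w ())) := fun k =>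
    (map_famAt (w k) _ _ _ fun s => rfl).symm
  simp only [h]
  rw [comp_map_right, ← map_trans]
  conv_rhs => rw [← P.one_comp (famAt l (w ()))]
  rfl

theorem act_map {K K' I : Type} [Finite K] [Finite K'] (e : K ≃ K') (p : P.obj K)
    (w : K' → P.Fam I) : act I (P.map e p) w = act I p fun k => w (e k) := fam_ext fun S _ l => by
  rw [famAt_act, famAt_act]
  refine (Fintype.sum_equiv ((Equiv.refl S).arrowCongr e) _ _ fun f => ?_).symm
  rw [actTerm_apply, actTerm_apply, comp_map_left, ← map_trans]
  have h : ∀ k, famAt (fun s : {s // ((Equiv.refl S).arrowCongr e f) s = e k} => l s) (w (e k)) =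
      P.map ((Equiv.refl S).subtypeEquiv fun s => by simp)
        (famAt (fun s : {s // f s = k} => l s) (w (e k))) :=
    fun k => (map_famAt (w (e k)) _ _ _ fun s => rfl).symm
  simp only [h]
  rw [comp_map_right, ← map_trans]
  exact congrArg (fun e => P.map e _) (Equiv.ext fun x => rfl)

/-- Maps to a disjoint union, as a map to the index set and maps on its fibres. -/
def arrowSigmaFiberEquiv (S K : Type) (J : K → Type) :
    (Σ f : S → K, ∀ k, {s // f s = k} → J k) ≃ (S → Σ k, J k) where
  toFun p s := ⟨p.1 s, p.2 (p.1 s) ⟨s, rfl⟩⟩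
  invFun h := ⟨fun s => (h s).1, fun k s => s.2 ▸ (h s.1).2⟩
  left_inv p := by
    obtain ⟨f, g⟩ := p
    simp only [Sigma.mk.injEq, true_and, heq_eq_eq]
    funext k ⟨s, hs⟩
    subst hs
    rfl
  right_inv h := rfl

theorem sum_arrow_sigma {M : Type*} [AddCommMonoid M] {S K : Type} [Finite S] [Finite K]
    {J : K → Type} [∀ k, Finite (J k)] (φ : (S → Σ k, J k) → M) :
    ∑ h, φ h = ∑ f : S → K, ∑ g : ∀ k, {s // f s = k} → J k,
      φ (arrowSigmaFiberEquiv S K J ⟨f, g⟩) := by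
  let : Fintype (Σ f : S → K, ∀ k, {s // f s = k} → J k) := Sigma.instFintype
  exact (Fintype.sum_equiv (arrowSigmaFiberEquiv S K J) _ _ fun _ => rfl).symm.trans
    (Fintype.sum_sigma _)

/-- The fibres of a map to a disjoint union. -/
def fiberFiberEquiv {S K : Type} {J : K → Type} (f : S → K) (g : ∀ k, {s // f s = k} → J k)
    (x : Σ k, J k) : {t : {s // f s = x.1} // g x.1 t = x.2} ≃
      {s // arrowSigmaFiberEquiv S K J ⟨f, g⟩ s = x} where
  toFun t := ⟨t.1.1, by
    obtain ⟨k, j⟩ := x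
    obtain ⟨⟨s, hs⟩, ht⟩ := t
    change f s = k at hs
    subst hs
    change g (f s) ⟨s, rfl⟩ = j at ht
    subst ht
    rfl⟩
  invFun s := ⟨⟨s.1, congrArg Sigma.fst s.2⟩, by
    obtain ⟨s, rfl⟩ := s
    rfl⟩
  left_inv _ := rfl
  right_inv _ := rfl

/-- Distributing `S` over `Σ k, J k` means distributing it over `K` and then each fibre over its `J
k`. Expanding the outer composition by multilinearity matches the terms, up to `comp_assoc`. -/
theorem act_comp {K I : Type} [Finite K] {J : K → Type} [∀ k, Finite (J k)] (p : P.obj K)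
    (q : ∀ k, P.obj (J k)) (w : (Σ k, J k) → P.Fam I) :
    act I (P.comp p q) w = act I p fun k => act I (q k) fun j => w ⟨k, j⟩ :=
  fam_ext fun S _ l => by
  classical
  rw [famAt_act, famAt_act, sum_arrow_sigma]
  refine Finset.sum_congr rfl fun f _ => ?_
  rw [actTerm_apply]
  simp only [famAt_act]
  let : ∀ k, Fintype ({s // f s = k} → J k) := fun k => Fintype.ofFinite _
  have hsum := (P.comp p).map_sum fun k (g : {s // f s = k} → J k) =>
    actTerm (q k) (fun s : {s // f s = k} => l s) g fun j => w ⟨k, j⟩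
  refine Eq.trans ?_ (congrArg (P.map (Equiv.sigmaFiberEquiv f)) hsum).symm
  rw [map_sum]
  refine Finset.sum_congr (by ext; simp) fun g _ => ?_
  simp only [actTerm_apply]
  rw [comp_map_right, ← map_trans]
  have h : ∀ x : Σ k, J k,
      famAt (fun s : {s // arrowSigmaFiberEquiv S K J ⟨f, g⟩ s = x} => l s) (w x) =
      P.map (fiberFiberEquiv f g x)
        (famAt (fun t : {t : {s // f s = x.1} // g x.1 t = x.2} => l t.1) (w x)) :=
    fun x => (map_famAt (w x) _ _ _ fun s => rfl).symm
  simp only [h]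
  rw [comp_map_right, ← map_trans, P.comp_assoc p q fun k j =>
    famAt (fun t : {t : {s // f s = k} // g k t = j} => l t.1) (w ⟨k, j⟩), ← map_trans]
  exact congrArg (fun e => P.map e _) (Equiv.ext fun x => rfl)

/-! ### Operations are determined by their values on families -/

open Classical in
/-- The family that is the unit at the sets with one element, labelled by `i`. -/
noncomputable def generic (P : SymmOperad.{u, v} R) {I : Type} (i : I) : P.Fam I :=
  -- There is one such `e` if the set is a singleton and none otherwise; summing over `e` makes
  -- naturality a reindexing.
  ⟨fun x => ∑ e : Unit ≃ x.S, if ∀ s, x.lab s = i then P.map e P.one else 0, fun x y e h => by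
    rw [map_sum]
    refine Fintype.sum_equiv ((Equiv.refl Unit).equivCongr e) _ _ fun f => ?_
    have h' : (∀ s, y.lab s = i) ↔ ∀ s, x.lab s = i := by
      rw [← e.forall_congr_right]
      simp only [h]
    rw [apply_ite (P.map e), map_zero, ← map_trans]
    simp only [h']
    rfl⟩

open Classical in
theorem famAt_generic {I S : Type} [Finite S] (l : S → I) (i : I) :
    famAt l (P.generic i) = ∑ e : Unit ≃ S, if ∀ s, l s = i then P.map e P.one else 0 := rfl

theorem famAt_generic_of_unique {I S : Type} [Finite S] [Unique S] (l : S → I) (i : I)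
    (h : ∀ s, l s = i) : famAt l (P.generic i) = P.map (Equiv.ofUnique Unit S) P.one := by
  rw [famAt_generic, Finset.sum_eq_single (Equiv.ofUnique Unit S)]
  · exact if_pos h
  · exact fun e _ he => absurd (Subsingleton.elim _ _) he
  · exact fun he => absurd (@Finset.mem_univ _ (_) _) he

/-- Only `f = id` contributes: if `f s ≠ s`, the fibre over `f s` contains `s`, whose label is
wrong, and the generic family vanishes there. -/
theorem famAt_act_generic {I : Type} [Finite I] (p : P.obj I) :
    famAt (id : I → I) (act I p P.generic) = p := by
  classical
  rw [famAt_act, Finset.sum_eq_single id]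
  · have h : ∀ i, famAt (fun s : {s : I // id s = i} => id s.1) (P.generic i) =
        P.map (Equiv.ofUnique Unit {s : I // s = i}) P.one := fun i =>
      famAt_generic_of_unique (S := {s : I // s = i}) _ i fun s => s.2
    rw [actTerm_apply]
    simp only [h]
    rw [comp_map_right, ← map_trans]
    conv_rhs => rw [← P.comp_one p]
    exact congrArg (fun e => P.map e _) (Equiv.ext fun x => rfl)
  · intro f _ hf
    obtain ⟨s, hs⟩ := Function.ne_iff.1 hf
    have h : famAt (fun t : {t : I // f t = f s} => id t.1) (P.generic (f s)) = 0 := by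
      rw [famAt_generic]
      exact Finset.sum_eq_zero fun e _ => if_neg fun h => hs (h ⟨s, rfl⟩).symm
    rw [actTerm_apply, (P.comp p).map_coord_zero (f s) h, map_zero]
  · exact fun he => absurd (@Finset.mem_univ _ (_) _) he

/-- Reduces identities in `P` to identities in one algebra, over any `R` and without division. -/
theorem act_injective {I : Type} [Finite I] {p q : P.obj I}
    (h : act I p P.generic = act I q P.generic) : p = q := by
  rw [← famAt_act_generic p, h, famAt_act_generic]

end SymmOperad

/-! ### Morphisms from free operads and their quotients -/

namespace SymmOperad

variable {R : Type u} [CommRing R]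

theorem Hom.ext {P : SymmOperad.{u, v} R} {Q : SymmOperad.{u, w} R} {φ ψ : Hom P Q}
    (h : ∀ (I : Type) [Finite I] (x : P.obj I), φ.app I x = ψ.app I x) : φ = ψ := by
  obtain ⟨f, _, _, _⟩ := φ
  obtain ⟨g, _, _, _⟩ := ψ
  obtain rfl : @f = @g := funext fun I => funext fun _ => LinearMap.ext fun x => h I x
  rfl

section FreeLift

variable {P : SymmOperad.{u, v} R} {G : Type} {ar : G → ℕ} (c : ∀ g, P.obj (Fin (ar g)))

/-- Existence is enough: faithfulness identifies the operation with `liftMon`, so no choice of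
decomposition of the tree enters. -/
theorem exists_act_eq_eval {I : Type} [Finite I] (t : Monomial ar I) :
    ∃ p : P.obj I, ∀ (L : Type) (w : I → P.Fam L),
      act L p w = t.1.eval (fun g a => act L (c g) a) w := by
  refine Monomial.induction (Q := fun I _ t => ∃ p : P.obj I, ∀ (L : Type) (w : I → P.Fam L),
    act L p w = t.1.eval (fun g a => act L (c g) a) w) ?_ ?_ ?_ t
  · exact ⟨P.one, fun L w => act_one w⟩
  · rintro I J _ _ e t ⟨p, hp⟩
    exact ⟨P.map e p, fun L w => by rw [act_map, hp, Monomial.relabel, OpTree.eval_map]⟩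
  · intro g J _ s ih
    choose p hp using ih
    refine ⟨P.comp (c g) p, fun L w => ?_⟩
    rw [act_comp, Monomial.graft, OpTree.eval_graft]
    simp only [hp]
    rfl

/-- The image of a monomial under the morphism that maps the generator `g` to `c g`. -/
noncomputable def liftMon {I : Type} (t : Monomial ar I) [Finite I] : P.obj I :=
  famAt id (t.1.eval (fun g a => act I (c g) a) P.generic)

theorem act_liftMon {I L : Type} [Finite I] (t : Monomial ar I) (w : I → P.Fam L) :
    act L (liftMon c t) w = t.1.eval (fun g a => act L (c g) a) w := by
  obtain ⟨p, hp⟩ := exists_act_eq_eval c t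
  rw [liftMon, ← hp, famAt_act_generic, hp]

theorem liftMon_relabel {I J : Type} [Finite I] [Finite J] (e : I ≃ J) (t : Monomial ar I) :
    liftMon c (t.relabel e) = P.map e (liftMon c t) := act_injective <| by
  rw [act_map, act_liftMon, act_liftMon, Monomial.relabel, OpTree.eval_map]

theorem liftMon_unit : liftMon c (Monomial.unit : Monomial ar Unit) = P.one :=
  act_injective <| by
    rw [act_one, act_liftMon]
    rfl

theorem liftMon_graft {I : Type} [Finite I] {J : I → Type} [∀ i, Finite (J i)]
    (t : Monomial ar I) (s : ∀ i, Monomial ar (J i)) :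
    liftMon c (t.graft s) = P.comp (liftMon c t) fun i => liftMon c (s i) :=
  act_injective <| by
    rw [act_comp, act_liftMon, act_liftMon, Monomial.graft, OpTree.eval_graft]
    simp only [act_liftMon]

theorem liftMon_corolla (g : G) : liftMon c (Monomial.corolla g) = c g := act_injective <| by
  rw [act_liftMon]
  rfl

/-- The morphism from the free operad that maps the generator `g` to `c g`. -/
noncomputable def freeLift : Hom (free R ar) P where
  app I _ := Finsupp.linearCombination R fun t : Monomial ar I => liftMon c t
  app_map {I J _ _} e x := by
    have h : (Finsupp.linearCombination R fun t : Monomial ar J => liftMon c t).comp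
        (Finsupp.lmapDomain R R (Monomial.relabel (ar := ar) e)) =
        (P.map e).comp (Finsupp.linearCombination R fun t : Monomial ar I => liftMon c t) := by
      ext t
      simp [liftMon_relabel]
    exact LinearMap.congr_fun h x
  app_one := by
    change Finsupp.linearCombination R _ (Finsupp.single Monomial.unit 1) = _
    rw [Finsupp.linearCombination_single, one_smul, liftMon_unit]
  app_comp {I _ J _} x y := by
    have h : (LinearMap.compMultilinearMapₗ R
          (Finsupp.linearCombination R fun t : Monomial ar (Σ i, J i) => liftMon c t)).comp
          (freeComp R ar (J := J)) =
        (MultilinearMap.compLinearMapₗ fun i =>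
          Finsupp.linearCombination R fun t : Monomial ar (J i) => liftMon c t).comp
          ((P.comp (J := J)).comp
            (Finsupp.linearCombination R fun t : Monomial ar I => liftMon c t)) := by
      refine mon_ext R ar _ _ fun t s => ?_
      simp only [LinearMap.comp_apply, MultilinearMap.compLinearMapₗ_apply,
        MultilinearMap.compLinearMap_apply, LinearMap.compMultilinearMapₗ_apply,
        LinearMap.compMultilinearMap_apply, freeComp_single, Finsupp.linearCombination_single,
        one_smul, liftMon_graft]
    exact congrArg (fun F => F x y) h

theorem freeLift_mon {I : Type} [Finite I] (t : OpTree ar I) (ht : t.IsMultilinear) :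
    (freeLift c).app I (mon R t ht) = liftMon c ⟨t, ht⟩ := by
  exact (Finsupp.linearCombination_single R (v := fun t : Monomial ar I => liftMon c t) 1
    ⟨t, ht⟩).trans (one_smul R _)

end FreeLift

/-- A morphism that kills the relators descends to the quotient. -/
noncomputable def Hom.quotLift {P : SymmOperad.{u, v} R} {Q : SymmOperad.{u, w} R}
    {rel : ∀ (I : Type) [Finite I], P.obj I → Prop} (φ : Hom P Q)
    (h : ∀ (I : Type) [Finite I] (x : P.obj I), rel I x → φ.app I x = 0) :
    Hom (P.quot rel) Q :=
  have key : ∀ (I : Type) [Finite I] (x : P.obj I), IdealMem P rel I x → φ.app I x = 0 := by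
    intro I _ x hx
    induction hx with
    | of x hx => exact h _ x hx
    | zero => exact map_zero _
    | add x y _ _ hx hy => rw [map_add, hx, hy, add_zero]
    | smul c x _ hx => rw [map_smul, hx, smul_zero]
    | map e x _ hx => rw [φ.app_map, hx, map_zero]
    | comp_left x y _ hx => rw [φ.app_comp, hx, map_zero]; rfl
    | comp_right x y i _ hy => rw [φ.app_comp, (Q.comp _).map_coord_zero i hy]
  { app := fun I _ => (P.ideal rel I).liftQ (φ.app I) fun x hx => key I x hx
    app_map := fun e x => by
      obtain ⟨x, rfl⟩ := Submodule.Quotient.mk_surjective _ x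
      exact φ.app_map e x
    app_one := φ.app_one
    app_comp := fun {I _ J _} x y => by
      obtain ⟨x, rfl⟩ := Submodule.Quotient.mk_surjective _ x
      obtain ⟨y, rfl⟩ := P.exists_rep rel y
      have := P.quotComp_mk rel x y
      change (P.ideal rel _).liftQ (φ.app _) _ (P.quotComp rel _ _) = _
      rw [this]
      exact φ.app_comp x y }

section QuotMon

variable {G : Type} {ar : G → ℕ}
  (rel : ∀ (I : Type) [Finite I], (free R ar).obj I → Prop)

/-- The class of a monomial in a quotient of the free operad. -/
noncomputable def quotMon {I : Type} [Finite I] (t : Monomial ar I) :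
    ((free R ar).quot rel).obj I :=
  toQuot (free R ar) rel (mon R t.1 t.2)

theorem quotMon_relabel {I J : Type} [Finite I] [Finite J] (e : I ≃ J) (t : Monomial ar I) :
    quotMon rel (t.relabel e) = ((free R ar).quot rel).map e (quotMon rel t) :=
  congrArg (toQuot (free R ar) rel) (lmap_single R ar e t).symm

theorem quotMon_graft {I : Type} [Finite I] {J : I → Type} [∀ i, Finite (J i)]
    (t : Monomial ar I) (s : ∀ i, Monomial ar (J i)) :
    quotMon rel (t.graft s) =
      ((free R ar).quot rel).comp (quotMon rel t) fun i => quotMon rel (s i) :=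
  (congrArg (toQuot (free R ar) rel) (freeComp_single R ar t s).symm).trans
    ((free R ar).quotComp_mk rel (mon R t.1 t.2) fun i => mon R (s i).1 (s i).2).symm

/-- Translates relations among monomials into identities between operations on families. -/
theorem act_quotMon {I L : Type} [Finite I] (t : Monomial ar I)
    (w : I → ((free R ar).quot rel).Fam L) :
    act L (quotMon rel t) w =
      t.1.eval (fun g a => act L (quotMon rel (Monomial.corolla g)) a) w := by
  refine Monomial.induction (Q := fun I _ t => ∀ w : I → ((free R ar).quot rel).Fam L,
    act L (quotMon rel t) w =
      t.1.eval (fun g a => act L (quotMon rel (Monomial.corolla g)) a) w) ?_ ?_ ?_ t w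
  · exact act_one
  · intro I J _ _ e t ih w
    rw [quotMon_relabel, act_map, ih, Monomial.relabel, OpTree.eval_map]
  · intro g J _ s ih w
    rw [quotMon_graft, act_comp, Monomial.graft, OpTree.eval_graft]
    simp only [ih]
    rfl

/-- Corollas generate all monomials under grafting and relabelling, and the classes of monomials
span the quotient. -/
theorem hom_ext_quot {Q : SymmOperad.{u, w} R} {φ ψ : Hom ((free R ar).quot rel) Q}
    (h : ∀ g, φ.app _ (quotMon rel (Monomial.corolla g)) =
      ψ.app _ (quotMon rel (Monomial.corolla g))) : φ = ψ := by
  have key : ∀ {I : Type} [Finite I] (t : Monomial ar I),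
      φ.app I (quotMon rel t) = ψ.app I (quotMon rel t) := by
    intro I _ t
    refine Monomial.induction (Q := fun I _ t =>
      φ.app I (quotMon rel t) = ψ.app I (quotMon rel t)) ?_ ?_ ?_ t
    · exact φ.app_one.trans ψ.app_one.symm
    · intro I J _ _ e t ih
      rw [quotMon_relabel, φ.app_map, ψ.app_map, ih]
    · intro g J _ s ih
      rw [quotMon_graft, φ.app_comp, ψ.app_comp, h]
      simp only [ih]
  refine Hom.ext fun I _ x => ?_
  obtain ⟨x, rfl⟩ := Submodule.Quotient.mk_surjective _ x
  have h' : (φ.app I).comp ((free R ar).ideal rel I).mkQ =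
      (ψ.app I).comp ((free R ar).ideal rel I).mkQ :=
    Finsupp.lhom_ext' fun t => LinearMap.ext_ring (key t)
  exact LinearMap.congr_fun h' x

end QuotMon

end SymmOperad

/-- A multilinear map with two arguments as a bilinear map. -/
def MultilinearMap.toBilinear {R A B : Type*} [CommRing R] [AddCommGroup A] [Module R A]
    [AddCommGroup B] [Module R B] (M : MultilinearMap R (fun _ : Fin 2 => A) B) :
    A →ₗ[R] A →ₗ[R] B :=
  have h₀ : ∀ a b c : A, Function.update ![a, b] 0 c = ![c, b] := fun a b c => by
    funext k
    fin_cases k <;> simp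
  have h₁ : ∀ a b c : A, Function.update ![a, b] 1 c = ![a, c] := fun a b c => by
    funext k
    fin_cases k <;> simp
  LinearMap.mk₂ R (fun a b => M ![a, b])
    (fun a a' b => by simpa only [h₀] using M.map_update_add ![a, b] 0 a a')
    (fun c a b => by simpa only [h₀] using M.map_update_smul ![a, b] 0 c a)
    (fun a b b' => by simpa only [h₁] using M.map_update_add ![a, b] 1 b b')
    (fun c a b => by simpa only [h₁] using M.map_update_smul ![a, b] 1 c b)

theorem MultilinearMap.toBilinear_apply {R A B : Type*} [CommRing R] [AddCommGroup A] [Module R A]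
    [AddCommGroup B] [Module R B] (M : MultilinearMap R (fun _ : Fin 2 => A) B) (a b : A) :
    M.toBilinear a b = M ![a, b] := rfl

/-! ### Multilinearity of evaluation -/

namespace OpTree

variable {G : Type} {ar : G → ℕ} {I : Type} {R : Type*} [CommRing R] {A : Type*} [AddCommGroup A]
  [Module R A] (o : ∀ g, (Fin (ar g) → A) → A)

/-- The label `i` occurs in exactly one child; the other children are constant in the value at `i`,
so the dependence is a composite of linear maps. -/
theorem exists_linear_eval (ho : ∀ g a k, ∃ L : A →ₗ[R] A, ∀ c, o g (Function.update a k c) = L c)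
    [DecidableEq I] (t : OpTree ar I) (i : I) (hi : t.occ i = 1) (v : I → A) :
    ∃ L : A →ₗ[R] A, ∀ c, t.eval o (Function.update v i c) = L c := by
  induction t with
  | var j =>
    obtain rfl : j = i := by
      by_contra h
      simp [occ, h] at hi
    exact ⟨LinearMap.id, fun c => by simp [eval]⟩
  | op g a ih =>
    obtain ⟨k, _, hk⟩ := Finset.exists_ne_zero_of_sum_ne_zero
      (s := Finset.univ) (f := fun k => (a k).occ i) (by rw [occ] at hi; rw [hi]; exact one_ne_zero)
    have hsum : (a k).occ i + ∑ k' ∈ Finset.univ.erase k, (a k').occ i = 1 := by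
      rw [Finset.add_sum_erase _ (fun k => (a k).occ i) (Finset.mem_univ k)]
      exact hi
    have h0 : ∀ k', k' ≠ k → (a k').occ i = 0 := fun k' hk' => by
      have h : ∑ k' ∈ Finset.univ.erase k, (a k').occ i = 0 := by omega
      exact Finset.sum_eq_zero_iff.1 h k' (Finset.mem_erase.2 ⟨hk', Finset.mem_univ _⟩)
    obtain ⟨L, hL⟩ := ih k (by omega)
    obtain ⟨L', hL'⟩ := ho g (fun k => (a k).eval o v) k
    refine ⟨L'.comp L, fun c => ?_⟩
    rw [LinearMap.comp_apply, ← hL, ← hL', eval]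
    congr 1
    funext k'
    by_cases hk' : k' = k
    · subst hk'
      rw [Function.update_self]
    · rw [Function.update_of_ne hk']
      refine eval_congr o _ _ _ fun j hj => Function.update_of_ne ?_ _ _
      rintro rfl
      exact hj (h0 k' hk')

theorem IsMultilinear.exists_multilinear_eval
    (ho : ∀ g a k, ∃ L : A →ₗ[R] A, ∀ c, o g (Function.update a k c) = L c)
    {t : OpTree ar I} (ht : t.IsMultilinear) :
    ∃ M : MultilinearMap R (fun _ : I => A) A, ∀ v, M v = t.eval o v := by
  refine ⟨⟨fun v => t.eval o v, fun v i a b => ?_, fun v i c a => ?_⟩, fun v => rfl⟩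
  · obtain ⟨L, hL⟩ := t.exists_linear_eval o ho i (ht i) v
    rw [hL, hL, hL, map_add]
  · obtain ⟨L, hL⟩ := t.exists_linear_eval o ho i (ht i) v
    rw [hL, hL, map_smul]

end OpTree

/-! ### Compatibility of the arrow and brace operations with maps -/

section Maps

variable {A B : Type*} (h : A → B)

theorem map_arrowTerm {p s : A → A → A} {p' s' : B → B → B}
    (hp : ∀ a b, h (p a b) = p' (h a) (h b)) (hs : ∀ a b, h (s a b) = s' (h a) (h b)) (z : A)
    (l : List A) (k : ℕ) : h (arrowTerm p s z l k) = arrowTerm p' s' (h z) (l.map h) k := by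
  have h1 : ∀ x l, h (upArrow p x l) = upArrow p' (h x) (l.map h) := by
    intro x l
    induction l generalizing x with
    | nil => rfl
    | cons y l ih => simp only [upArrow, List.map_cons, hp, ih]
  have h2 : ∀ x l, h (downArrow s x l) = downArrow s' (h x) (l.map h) := by
    intro x l
    induction l generalizing x with
    | nil => rfl
    | cons y l ih => exact (ih (s x y)).trans (by rw [hs]; rfl)
  have h3 : ∀ x l, h (upSucc p s l x) = upSucc p' s' (l.map h) (h x) := by
    intro x l
    cases l with
    | nil => rfl
    | cons y l => simp only [upSucc, List.map_cons, hs, h1]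
  have h4 : ∀ x l, h (precDown p s x l) = precDown p' s' (h x) (l.map h) := by
    intro x l
    cases l with
    | nil => rfl
    | cons y l => simp only [precDown, List.map_cons, hp, h2]
  rw [arrowTerm, h4, h3, arrowTerm, List.map_take, List.map_drop]

variable {br : A → List A → A} {br' : B → List B → B}

theorem map_braceLHS (hb : ∀ z l, h (br z l) = br' (h z) (l.map h)) {n m : ℕ} (z : A)
    (x : Fin n → A) (y : Fin m → A) :
    h (braceLHS br z x y) = braceLHS br' (h z) (fun a => h (x a)) fun a => h (y a) := by
  simp only [braceLHS, hb, List.map_ofFn]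
  rfl

theorem map_braceRHS (hb : ∀ z l, h (br z l) = br' (h z) (l.map h)) {n m : ℕ} (z : A)
    (x : Fin n → A) (y : Fin m → A) (f : Fin m → Fin (2 * n + 1)) :
    h (braceRHS br z x y f) = braceRHS br' (h z) (fun a => h (x a)) (fun a => h (y a)) f := by
  simp only [braceRHS, hb, braceArgs, List.map_append, List.map_flatMap, List.map_cons, block,
    List.map_map]
  rfl

end Maps

/-! ### Dendriform algebras are brace algebras. -/

namespace DendriformAlgebra

variable {R : Type u} [CommRing R] {W : Type w} [AddCommGroup W] [Module R W]
  (D : DendriformAlgebra R W)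

/-- The binary operation given by a generator of `Dend`. -/
def op : DendOperad.Gen → W → W → W
  | .prec => fun a b => D.prec a b
  | .succ => fun a b => D.succ a b

/-- The operations given by the generators of `Dend`, with arguments in a tuple. -/
def ops (g : DendOperad.Gen) (a : Fin (DendOperad.ar g) → W) : W := D.op g (a 0) (a 1)

theorem eval_arrowTerm {I : Type} (v : I → W) (z : OpTree DendOperad.ar I)
    (l : List (OpTree DendOperad.ar I)) (k : ℕ) :
    (arrowTerm DendOperad.prec DendOperad.succ z l k).eval D.ops v =
      arrowTerm (fun a b => D.prec a b) (fun a b => D.succ a b) (z.eval D.ops v)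
        (l.map fun t => t.eval D.ops v) k :=
  map_arrowTerm (fun t => t.eval D.ops v) (fun _ _ => rfl) (fun _ _ => rfl) z l k

theorem brace_ofFn {n : ℕ} (v : Fin (n + 1) → W) :
    D.brace (v 0) (List.ofFn fun i : Fin n => v i.succ) =
      ∑ k ∈ Finset.range (n + 1), (-1 : R) ^ k •
        (arrowTerm DendOperad.prec DendOperad.succ (.var 0 : OpTree DendOperad.ar (Fin (n + 1)))
          (List.ofFn fun a : Fin n => .var a.succ) k).eval D.ops v := by
  rw [brace, List.length_ofFn]
  simp only [eval_arrowTerm, List.map_ofFn]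
  rfl

theorem isBraceAlgebra : IsBraceAlgebra R D.brace where
  nil := D.brace_nil
  multilinear n := by
    have ho : ∀ g a k, ∃ L : W →ₗ[R] W, ∀ c, D.ops g (Function.update a k c) = L c := by
      intro g a k
      cases g <;> fin_cases k
      · exact ⟨D.prec.flip (a 1), fun c => by simp [ops, op]⟩
      · exact ⟨D.prec (a 0), fun c => by simp [ops, op]⟩
      · exact ⟨D.succ.flip (a 1), fun c => by simp [ops, op]⟩
      · exact ⟨D.succ (a 0), fun c => by simp [ops, op]⟩
    choose M hM using fun k =>
      (DendOperad.isMultilinear_arrowTerm n k).exists_multilinear_eval D.ops ho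
    refine ⟨∑ k ∈ Finset.range (n + 1), (-1 : R) ^ k • M k, fun v => ?_⟩
    rw [brace_ofFn]
    simp [hM]
  rel _ _ := D.brace_rel

end DendriformAlgebra

/-! ### The morphism from `Brace` to `Dend` -/

namespace DendOperad

open SymmOperad

variable (R : Type u) [CommRing R]

/-- The class of a generator in `Dend`. -/
noncomputable def gen (g : Gen) : (Dend R).obj (Fin 2) := quotMon (Rel R) (Monomial.corolla g)

/-- The bilinear operation on families given by a generator of `Dend`. -/
noncomputable def famOp (L : Type) (g : Gen) :
    (Dend R).Fam L →ₗ[R] (Dend R).Fam L →ₗ[R] (Dend R).Fam L :=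
  (act L (gen R g)).toBilinear

theorem act_gen {L : Type} (g : Gen) (a : Fin 2 → (Dend R).Fam L) :
    act L (gen R g) a = famOp R L g (a 0) (a 1) := by
  refine Eq.trans ?_ (MultilinearMap.toBilinear_apply (act L (gen R g)) _ _).symm
  congr 1
  funext k
  fin_cases k <;> rfl

theorem act_mon {I L : Type} [Finite I] (t : OpTree ar I) (ht : t.IsMultilinear)
    (w : I → (Dend R).Fam L) :
    act L (toQuot _ _ (mon R t ht) : (Dend R).obj I) w =
      t.eval (fun g a => famOp R L g (a 0) (a 1)) w :=
  (act_quotMon (Rel R) ⟨t, ht⟩ w).trans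
    (congrArg (fun o => t.eval o w) (funext fun g => funext fun a => act_gen R g a))

theorem act_rel {I L : Type} [Finite I] {x : (free R ar).obj I} (hx : Rel R I x)
    (w : I → (Dend R).Fam L) : act L (toQuot _ _ x : (Dend R).obj I) w = 0 := by
  have h : (toQuot _ _ x : (Dend R).obj I) = 0 :=
    (Submodule.Quotient.mk_eq_zero _).2 (IdealMem.of x hx)
  exact (congrArg (fun p => act L p w) h).trans (map_zero (actHom w))

/-- `toQuot` as a linear map, followed by the action on families. -/
noncomputable def actQuot {I L : Type} [Finite I] (w : I → (Dend R).Fam L) :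
    (free R ar).obj I →ₗ[R] (Dend R).Fam L :=
  (actHom (P := Dend R) w).comp ((free R ar).ideal (Rel R) I).mkQ

/-- The natural families over `Dend` form a dendriform algebra. -/
noncomputable def famDendriform (L : Type) : DendriformAlgebra R ((Dend R).Fam L) where
  prec := famOp R L .prec
  succ := famOp R L .succ
  prec_prec x y z := by
    have h : actQuot R ![x, y, z] _ = 0 := act_rel R Rel.prec_prec ![x, y, z]
    rw [map_sub, map_add, sub_eq_zero] at h
    exact (act_mon R _ (isMultilinear_left _ _) ![x, y, z]).symm.trans (h.trans
      (congrArg₂ _ (act_mon R _ (isMultilinear_right _ _) ![x, y, z])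
        (act_mon R _ (isMultilinear_right _ _) ![x, y, z])))
  succ_prec x y z := by
    have h : actQuot R ![x, y, z] _ = 0 := act_rel R Rel.succ_prec ![x, y, z]
    rw [map_sub, sub_eq_zero] at h
    exact (act_mon R _ (isMultilinear_left _ _) ![x, y, z]).symm.trans (h.trans
      (act_mon R _ (isMultilinear_right _ _) ![x, y, z]))
  succ_succ x y z := by
    have h : actQuot R ![x, y, z] _ = 0 := act_rel R Rel.succ_succ ![x, y, z]
    rw [map_sub, map_add, sub_eq_zero] at h
    exact (act_mon R _ (isMultilinear_right _ _) ![x, y, z]).symm.trans (h.trans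
      (congrArg₂ _ (act_mon R _ (isMultilinear_left _ _) ![x, y, z])
        (act_mon R _ (isMultilinear_left _ _) ![x, y, z])))

theorem ops_famDendriform (L : Type) :
    (famDendriform R L).ops = fun g a => famOp R L g (a 0) (a 1) := by
  funext g a
  cases g <;> rfl

/-- Makes `brace_rel` for the dendriform algebra of families available for elements of `Dend`. -/
theorem act_dendCorolla {L : Type} (n : ℕ) (w : Fin (n + 1) → (Dend R).Fam L) :
    act L (dendCorolla R n) w =
      (famDendriform R L).brace (w 0) (List.ofFn fun i : Fin n => w i.succ) := by
  rw [DendriformAlgebra.brace_ofFn, ops_famDendriform]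
  refine (map_sum (actHom w) _ _).trans (Finset.sum_congr rfl fun k _ => ?_)
  exact (map_smul (actHom w) _ _).trans (congrArg _ (act_mon R _ _ w))

end DendOperad

namespace BraceOperad

open SymmOperad

theorem bracket_ofFn {I : Type} (z : OpTree ar I) {n : ℕ} (x : Fin (n + 1) → OpTree ar I) :
    bracket z (List.ofFn x) = .op n (Fin.cons z x) := by
  -- The vertex index in `bracket` is a list length, equal to `n` only propositionally; generalizing
  -- it allows the equality to be eliminated.
  have key : ∀ (n' : ℕ) (h : n' = n) (y : Fin (n' + 1) → OpTree ar I),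
      (∀ i, y i = x (i.cast (by rw [h]))) →
      (OpTree.op n' (Fin.cons z y) : OpTree ar I) = .op n (Fin.cons z x) := by
    rintro n' rfl y hy
    congr 2
    exact funext hy
  rw [List.ofFn_succ]
  refine key _ List.length_ofFn _ fun i => ?_
  refine Fin.cases rfl (fun i => ?_) i
  simp
  rfl

variable (R : Type u) [CommRing R]

theorem corolla_eq (n : ℕ) :
    _root_.corolla R (n + 1) = quotMon (Rel R) (Monomial.corolla n) := by
  rw [_root_.corolla, quotMon]
  have h : ∀ (t t' : OpTree ar (Fin (n + 2))) (ht : t.IsMultilinear) (ht' : t'.IsMultilinear),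
      t = t' → mon R t ht = mon R t' ht' := by
    rintro t _ ht _ rfl
    rfl
  refine congrArg (toQuot _ _) (h _ _ _ _ ((bracket_ofFn _ _).trans (congrArg _ ?_)))
  funext k
  exact Fin.cases rfl (fun i => rfl) k

/-- The morphism from the free operad to `Dend`. -/
noncomputable def toDend : Hom (free R ar) (Dend R) := freeLift fun g => dendCorolla R (g + 1)

theorem act_toDend_mon {I L : Type} [Finite I] (t : OpTree ar I) (ht : t.IsMultilinear)
    (w : I → (Dend R).Fam L) :
    act L ((toDend R).app I (mon R t ht)) w =
      t.eval (fun _ a => (DendOperad.famDendriform R L).brace (a 0)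
        (List.ofFn fun i => a i.succ)) w := by
  refine (congrArg (fun p => act L p w) (freeLift_mon _ t ht)).trans
    ((act_liftMon _ _ w).trans ?_)
  simp only [DendOperad.act_dendCorolla]

/-- Empty intervals produce brackets without a vertex, whence the normalization `hbr`. -/
theorem eval_bracket {A : Type*} (br : A → List A → A) (hbr : ∀ z, br z [] = z) {I : Type}
    (v : I → A) (z : OpTree ar I) (l : List (OpTree ar I)) :
    (bracket z l).eval (fun _ a => br (a 0) (List.ofFn fun i => a i.succ)) v =
      br (z.eval (fun _ a => br (a 0) (List.ofFn fun i => a i.succ)) v)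
        (l.map fun t => t.eval (fun _ a => br (a 0) (List.ofFn fun i => a i.succ)) v) := by
  cases l with
  | nil => exact (hbr _).symm
  | cons a l =>
    simp only [bracket, OpTree.eval, Fin.cons_zero, Fin.cons_succ]
    congr 1
    exact List.map_ofFn.symm.trans (congrArg _ (List.ofFn_get _))

/-- Tested on the generic families, the relator becomes the brace relation in the dendriform algebra
of families. -/
theorem toDend_rel (I : Type) [Finite I] (x : (free R ar).obj I) (hx : Rel R I x) :
    (toDend R).app I x = 0 := by
  obtain ⟨n, m, _, _⟩ := hx
  refine act_injective ?_
  rw [← actHom_apply, ← actHom_apply, map_zero, map_sub, map_sub, map_sum, map_sum, sub_eq_zero]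
  simp only [actHom_apply, act_toDend_mon]
  have hb := eval_bracket (DendOperad.famDendriform R (Vars n m)).brace
    (DendOperad.famDendriform R (Vars n m)).brace_nil (Dend R).generic
  rw [map_braceLHS _ hb]
  simp only [map_braceRHS _ hb]
  exact (DendOperad.famDendriform R (Vars n m)).brace_rel _ _ _

end BraceOperad

theorem mainTheorem8 (R : Type u) [CommRing R] :
    (∃! ψ : SymmOperad.Hom (Brace R) (Dend R),
      ∀ n : ℕ, 1 ≤ n → ψ.app (Fin (n + 1)) (corolla R n) = dendCorolla R n) ∧
    ∀ (W : Type w) [AddCommGroup W] [Module R W] (D : DendriformAlgebra R W),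
      IsBraceAlgebra R D.brace := by
  refine ⟨⟨(BraceOperad.toDend R).quotLift (BraceOperad.toDend_rel R), fun n hn => ?_,
    fun φ hφ => ?_⟩, fun W _ _ D => D.isBraceAlgebra⟩
  · obtain ⟨n, rfl⟩ := Nat.exists_eq_add_of_le' hn
    rw [BraceOperad.corolla_eq]
    exact (SymmOperad.freeLift_mon _ _ _).trans (SymmOperad.liftMon_corolla
      (fun g => dendCorolla R (g + 1)) n)
  · refine SymmOperad.hom_ext_quot (BraceOperad.Rel R) fun n => ?_
    -- The generator of index `n` is `Cₙ₊₁`, so the hypothesis on `φ` for `n + 1 ≥ 1` covers all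
    -- generators.
    rw [← BraceOperad.corolla_eq]
    refine (hφ (n + 1) (Nat.le_add_left 1 n)).trans ?_
    rw [BraceOperad.corolla_eq]
    exact ((SymmOperad.freeLift_mon _ _ _).trans (SymmOperad.liftMon_corolla
      (fun g => dendCorolla R (g + 1)) n)).symm
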